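/- Let $\mathbb T_d$ be the infinite rooted $d$-ary tree. For $q,p\in[0,1]$ the frog model $\mathrm{FM}(d,q,p)$ with death $1-q$ and drift $p$ is the following process in discrete time. Initially there is one active frog at the root and one sleeping frog at every other vertex. At each time step every living active frog, independently of everything else, dies with probability $1-q$ and otherwise jumps: from a non-root vertex it moves to the parent with probability $p$ and to a uniformly chosen child with probability $1-p$; from the root it stays in place with probability $p$ and moves to a uniformly chosen child with probability $1-p$. A sleeping frog becomes active when an active frog visits its vertex. A realization is recurrent if the root is visited by infinitely many active frogs. **Corollary 1.3.** Let $d\ge 2$ be an integer and let $q\in[0.9999998,1)$. Then: 1. $\mathbf P(\mathrm{FM}(d,q,p)\text{ is recurrent})=0$ for all $p\in[0,1]$ with $p<\frac1{1+qd}$ or $p\ge 2-q^{-1}$; 2. $\mathbf P(\mathrm{FM}(d,q,p)\text{ is recurrent})>0$ for all $p\in[0.4950,0.4975]$; 3. consequently, for these fixed $d$ and $q$, the function $p\mapsto \mathbf P(\mathrm{FM}(d,q,p)\text{ is recurrent})$ is not monotone on $(0,1)$: it is neither nondecreasing nor nonincreasing. -/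

import Mathlib

open MeasureTheory

namespace FrogModel

/-- The vertices of the infinite rooted `d`-ary tree: a vertex is the list of child choices that
leads to it from the root, the most recent choice first. The root is `[]`, the children of `x` are
`i :: x` for `i : Fin d`, and the parent of `x ≠ []` is `x.tail`. -/
abbrev Vertex (d : ℕ) : Type := List (Fin d)

/-- What an active frog does at one time step: it dies before jumping, it survives and moves
towards the root, or it survives and moves to its `i`-th child. -/
inductive Step (d : ℕ) : Type
  | die : Step d
  | toRoot : Step d
  | toChild (i : Fin d) : Step d

instance (d : ℕ) : MeasurableSpace (Step d) := ⊤

/-- The law of one step: death with probability `1 - q`; given survival (probability `q`), towards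
the root with probability `p`, and to each of the `d` children with probability `(1 - p) / d`. -/
noncomputable def stepLaw (d : ℕ) (q p : ℝ) : Measure (Step d) :=
  ENNReal.ofReal (1 - q) • Measure.dirac Step.die
    + ENNReal.ofReal (q * p) • Measure.dirac Step.toRoot
    + ∑ i : Fin d, ENNReal.ofReal (q * ((1 - p) / d)) • Measure.dirac (Step.toChild i)

theorem isProbabilityMeasure_stepLaw {d : ℕ} {q p : ℝ} (hd : 1 ≤ d) (hq : q ∈ Set.Icc (0 : ℝ) 1)
    (hp : p ∈ Set.Icc (0 : ℝ) 1) : IsProbabilityMeasure (stepLaw d q p) := by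
  obtain ⟨hq0, hq1⟩ := hq
  obtain ⟨hp0, hp1⟩ := hp
  have hd' : (0 : ℝ) < d := by exact_mod_cast hd
  have h1 : 0 ≤ q * p := mul_nonneg hq0 hp0
  have h2 : 0 ≤ q * ((1 - p) / d) := mul_nonneg hq0 (div_nonneg (by linarith) hd'.le)
  constructor
  simp only [stepLaw, Measure.add_apply, Measure.smul_apply, Measure.finsetSum_apply, measure_univ,
    smul_eq_mul, mul_one, Finset.sum_const, Finset.card_univ, Fintype.card_fin, nsmul_eq_mul]
  rw [← ENNReal.ofReal_natCast, ← ENNReal.ofReal_mul hd'.le,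
    ← ENNReal.ofReal_add (by linarith) h1, ← ENNReal.ofReal_add (by linarith) (by positivity),
    ← ENNReal.ofReal_one]
  congr 1
  field_simp
  ring

/-- The randomness of the model: `ω (v, n)` is the step taken by the frog initially at `v` at the
`(n + 1)`-st time step after it became active. -/
abbrev Instructions (d : ℕ) : Type := Vertex d × ℕ → Step d

/-- All steps of all frogs are independent with the law `stepLaw d q p`. -/
noncomputable def law (d : ℕ) (q p : ℝ) : Measure (Instructions d) :=
  Measure.infinitePi fun _ => stepLaw d q p

/-- The effect of a step on a living frog at `x`; `none` means that the frog is dead. A step towards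
the root made at the root leaves the frog in place (`[].tail = []`). -/
def move {d : ℕ} (x : Vertex d) : Step d → Option (Vertex d)
  | Step.die => none
  | Step.toRoot => some x.tail
  | Step.toChild i => some (i :: x)

/-- Position, `k` time steps after its activation, of the frog initially at `v`
(`none` if it has died). -/
def walk {d : ℕ} (ω : Instructions d) (v : Vertex d) : ℕ → Option (Vertex d)
  | 0 => some v
  | k + 1 => (walk ω v k).bind fun x => move x (ω (v, k))

open Classical in
/-- The frog model in discrete time. `age ω t v = none` if the frog initially at `v` is still asleep
at time `t`, and `age ω t v = some k` if it was activated at time `t - k`. At time `0` only the frog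
at the root is active. At each time step all active frogs make their next step simultaneously, and
a sleeping frog becomes active when one of them moves to its vertex. -/
noncomputable def age {d : ℕ} (ω : Instructions d) : ℕ → Vertex d → Option ℕ
  | 0, v => if v = [] then some 0 else none
  | t + 1, v =>
    match age ω t v with
    | some k => some (k + 1)
    | none => if ∃ u k, age ω t u = some k ∧ walk ω u (k + 1) = some v then some 0 else none

/-- An active (living) frog, initially at `v`, is at the vertex `x` at time `t`. -/
def ActiveAt {d : ℕ} (ω : Instructions d) (t : ℕ) (v x : Vertex d) : Prop :=
  ∃ k, age ω t v = some k ∧ walk ω v k = some x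

/-- A realization is recurrent if the root is visited by infinitely many active frogs. -/
def Recurrent {d : ℕ} (ω : Instructions d) : Prop :=
  {v : Vertex d | ∃ t, ActiveAt ω t v []}.Infinite

/-- The probability that the frog model with death `1 - q` and drift `p` on the `d`-ary tree is
recurrent. -/
noncomputable def recurrenceProb (d : ℕ) (q p : ℝ) : ℝ :=
  (law d q p).real {ω | Recurrent ω}

end FrogModel

/-! The steps of different frogs are independent, and the path of a frog after activation does not
depend on when it is activated. Each regime therefore reduces to estimates for a single killed walk.

Weak drift. Ignore activation and count all frogs whose path would meet the root. If `q * p + q * (1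
- p) * x ^ 2 ≤ x`, then `x ^ v.length` is superharmonic off the root and bounds the probability of
hitting it from `v`. For `p < 1 / (1 + q * d)` some `x < 1 / d` qualifies, so the expected count is
at most `∑ (d * x) ^ n < ∞`, and Borel–Cantelli applies (`recurrenceProb_eq_zero_of_lt`).

Strong drift. A frog wakes new frogs only by steps away from the root, whose mean number over its
lifetime is `q * (1 - p) / (1 - q)`. This is at most `1` when `p ≥ 2 - q⁻¹`. Some of these steps
lead back to a vertex already visited, so the mean number of discoveries is strictly below `1`.
Activation is then dominated by a subcritical branching process: the expected number of chains of
discoveries from the root is finite, so almost surely only finitely many frogs wake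
(`tsum_measure_genealogy_le`, `exists_genealogy`, `recurrenceProb_eq_zero_of_le`).

Intermediate drift. Subharmonic functions give lower bounds `h = 0.95` and `g = 0.95 / d` for the
cost of one edge towards the root and one edge away from it (`geodesicWeight_le_measure_hits`).
Since `d * g < 1`, waking children one level at a time is not shown to be supercritical by these
bounds. Over two levels, a grandchild can be reached directly or with the help of the child's frog,
with probability at least `ρ = 2 * g ^ 2 - g ^ 3`, and `d ^ 2 * ρ * h ^ 2 > 1`. A second moment
argument then shows that, with probability bounded below uniformly in `n`, some frog from level `2 *
n` is woken by relays and visits the root; this happens for infinitely many `n` with positive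
probability (`inv_le_measure_iUnion_reach_hits`, `le_measureReal_limsup`).

Monotonicity fails because a positive value lies between two zeros. -/

namespace FrogModel

open ProbabilityTheory
open scoped ENNReal

/-! ### Independence of instructions and the Markov property. -/

section Foundations

variable {d : ℕ} {q p : ℝ}

/-- Steps are death, a move towards the root, or the choice of a child. -/
def stepEquiv (d : ℕ) : Option (Option (Fin d)) ≃ Step d where
  toFun
    | none => .die
    | some none => .toRoot
    | some (some i) => .toChild i
  invFun
    | .die => none
    | .toRoot => some none
    | .toChild i => some (some i)
  left_inv := by rintro (_ | _ | i) <;> rfl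
  right_inv := by rintro (_ | _ | i) <;> rfl

noncomputable instance : Fintype (Step d) := Fintype.ofEquiv _ (stepEquiv d)

theorem sum_step {M : Type*} [AddCommMonoid M] (f : Step d → M) :
    ∑ s, f s = f .die + (f .toRoot + ∑ i, f (.toChild i)) := by
  rw [← (stepEquiv d).sum_comp, Fintype.sum_option, Fintype.sum_option]
  rfl

theorem stepLaw_toRoot : stepLaw d q p {.toRoot} = ENNReal.ofReal (q * p) := by
  simp [stepLaw]

theorem stepLaw_toChild (i : Fin d) :
    stepLaw d q p {.toChild i} = ENNReal.ofReal (q * ((1 - p) / d)) := by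
  classical
  simp [stepLaw, Set.indicator_apply]

theorem stepLaw_range_toChild (hq : 0 ≤ q) (hp : p ∈ Set.Icc (0 : ℝ) 1) (hd : 1 ≤ d) :
    stepLaw d q p (Set.range .toChild) = ENNReal.ofReal (q * (1 - p)) := by
  have hd' : (0 : ℝ) < d := by exact_mod_cast hd
  have h2 : 0 ≤ q * ((1 - p) / d) := mul_nonneg hq (div_nonneg (by linarith [hp.2]) hd'.le)
  have hi (x : Fin d) : (Set.range Step.toChild).indicator (1 : Step d → ℝ≥0∞) (.toChild x) = 1 :=
    Set.indicator_of_mem (Set.mem_range_self x) _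
  simp only [stepLaw, Measure.add_apply, Measure.smul_apply, Measure.finsetSum_apply,
    Measure.dirac_apply, smul_eq_mul, hi, Set.mem_range, reduceCtorEq, exists_false,
    not_false_eq_true, Set.indicator_of_notMem, mul_zero, zero_add, mul_one, Finset.sum_const,
    Finset.card_univ, Fintype.card_fin, nsmul_eq_mul]
  rw [← ENNReal.ofReal_natCast, ← ENNReal.ofReal_mul hd'.le]
  congr 1
  field_simp

theorem stepLaw_compl_die (hq : 0 ≤ q) (hp : p ∈ Set.Icc (0 : ℝ) 1) (hd : 1 ≤ d) :
    stepLaw d q p {.die}ᶜ = ENNReal.ofReal q := by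
  have h : ({.die}ᶜ : Set (Step d)) = {.toRoot} ∪ Set.range .toChild := by
    ext s
    cases s <;> simp
  rw [h, measure_union (by simp) MeasurableSpace.measurableSet_top, stepLaw_toRoot,
    stepLaw_range_toChild hq hp hd,
    ← ENNReal.ofReal_add (mul_nonneg hq hp.1) (mul_nonneg hq (by linarith [hp.2]))]
  congr 1
  ring

/-- The σ-algebra generated by the instructions with index in `S`. -/
abbrev instrSigma (S : Set (Vertex d × ℕ)) : MeasurableSpace (Instructions d) :=
  ⨆ i ∈ S, MeasurableSpace.comap (fun ω => ω i) ⊤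

theorem instrSigma_mono {S T : Set (Vertex d × ℕ)} (h : S ⊆ T) : instrSigma S ≤ instrSigma T :=
  biSup_mono h

theorem instrSigma_le (S : Set (Vertex d × ℕ)) : instrSigma S ≤ MeasurableSpace.pi :=
  iSup₂_le fun i _ => (measurable_pi_apply i).comap_le

theorem measurableSet_instr {S : Set (Vertex d × ℕ)} {i : Vertex d × ℕ} (hi : i ∈ S)
    (T : Set (Step d)) : MeasurableSet[instrSigma S] {ω : Instructions d | ω i ∈ T} :=
  (le_iSup₂ (f := fun i (_ : i ∈ S) =>
    MeasurableSpace.comap (fun ω : Instructions d => ω i) ⊤) i hi) _ ⟨T, trivial, rfl⟩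

instance [IsProbabilityMeasure (stepLaw d q p)] : IsProbabilityMeasure (law d q p) := by
  unfold law; infer_instance

/-- All independence below is read off from disjointness of the sets of instructions on which events
depend. -/
theorem indep_instrSigma [IsProbabilityMeasure (stepLaw d q p)] {S T : Set (Vertex d × ℕ)}
    (h : Disjoint S T) : Indep (instrSigma S) (instrSigma T) (law d q p) := by
  refine indep_iSup_of_disjoint (fun i => (measurable_pi_apply i).comap_le) ?_ h
  exact iIndepFun_infinitePi (P := fun _ : Vertex d × ℕ => stepLaw d q p)
    (X := fun _ ω => ω) (fun _ => measurable_id)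

theorem measure_inter_of_disjoint [IsProbabilityMeasure (stepLaw d q p)]
    {S T : Set (Vertex d × ℕ)} (h : Disjoint S T) {A B : Set (Instructions d)}
    (hA : MeasurableSet[instrSigma S] A) (hB : MeasurableSet[instrSigma T] B) :
    law d q p (A ∩ B) = law d q p A * law d q p B :=
  (Indep_iff _ _ _).1 (indep_instrSigma h) A B hA hB

theorem law_instr [IsProbabilityMeasure (stepLaw d q p)] (i : Vertex d × ℕ) (T : Set (Step d)) :
    law d q p {ω | ω i ∈ T} = stepLaw d q p T := by
  have := Measure.infinitePi_map_eval (fun _ : Vertex d × ℕ => stepLaw d q p) i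
  conv_rhs =>
    rw [← this, Measure.map_apply (measurable_pi_apply i) MeasurableSpace.measurableSet_top]
  rfl

/-- The instructions of the frogs initially in `U`. -/
def rows (U : Set (Vertex d)) : Set (Vertex d × ℕ) := {i | i.1 ∈ U}

theorem rows_mono {U V : Set (Vertex d)} (h : U ⊆ V) : rows U ⊆ rows V := fun _ hi => h hi

theorem disjoint_rows {U V : Set (Vertex d)} (h : Disjoint U V) : Disjoint (rows U) (rows V) :=
  Set.disjoint_left.2 fun _ hU hV => Set.disjoint_left.1 h hU hV

/-- The first `k` instructions of the frog initially at `v`. -/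
def past (v : Vertex d) (k : ℕ) : Set (Vertex d × ℕ) := {i | i.1 = v ∧ i.2 < k}

theorem past_subset_rows (v : Vertex d) (k : ℕ) : past v k ⊆ rows {v} := fun _ hi => hi.1

theorem past_mono (v : Vertex d) {k l : ℕ} (h : k ≤ l) : past v k ⊆ past v l :=
  fun _ hi => ⟨hi.1, hi.2.trans_le h⟩

theorem measure_inter_step [IsProbabilityMeasure (stepLaw d q p)] {v : Vertex d} {k : ℕ}
    {A : Set (Instructions d)} (hA : MeasurableSet[instrSigma (past v k)] A) (T : Set (Step d)) :
    law d q p (A ∩ {ω | ω (v, k) ∈ T}) = law d q p A * stepLaw d q p T := by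
  have h : Disjoint (past v k) {(v, k)} :=
    Set.disjoint_singleton_right.2 fun h => lt_irrefl _ h.2
  rw [measure_inter_of_disjoint h hA (measurableSet_instr (Set.mem_singleton _) T), law_instr]

/-- A process driven by the successive instructions of the frog initially at `v`. -/
def driven (F : Option (Vertex d) → Step d → Option (Vertex d)) (v : Vertex d)
    (ω : Instructions d) : ℕ → Option (Vertex d)
  | 0 => some v
  | k + 1 => F (driven F v ω k) (ω (v, k))

theorem walk_eq_driven (ω : Instructions d) (v : Vertex d) (k : ℕ) :
    walk ω v k = driven (fun o s => o.bind fun x => move x s) v ω k := by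
  induction k with
  | zero => rfl
  | succ k ih => simp only [walk, driven, ih]

theorem measurableSet_driven (F : Option (Vertex d) → Step d → Option (Vertex d)) (v : Vertex d)
    (k : ℕ) (o : Option (Vertex d)) :
    MeasurableSet[instrSigma (past v k)] {ω | driven F v ω k = o} := by
  induction k generalizing o with
  | zero => exact @MeasurableSet.const _ (instrSigma _) (some v = o)
  | succ k ih =>
    have : {ω | driven F v ω (k + 1) = o} = ⋃ (o' : Option (Vertex d)) (s : Step d)
        (_ : F o' s = o), {ω | driven F v ω k = o'} ∩ {ω | ω (v, k) ∈ ({s} : Set (Step d))} := by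
      ext ω
      simp [driven]
    rw [this]
    have hk : (v, k) ∈ past v (k + 1) := ⟨rfl, k.lt_succ_self⟩
    let _ := instrSigma (past v (k + 1))
    refine .iUnion fun o' => .iUnion fun s => .iUnion fun _ => .inter ?_ ?_
    · exact instrSigma_mono (past_mono v k.le_succ) _ (ih o')
    · exact measurableSet_instr hk {s}

theorem measurableSet_walk (v : Vertex d) (k : ℕ) (o : Option (Vertex d)) :
    MeasurableSet[instrSigma (past v k)] {ω | walk ω v k = o} := by
  simp only [walk_eq_driven]
  exact measurableSet_driven _ v k o

theorem measurableSet_pi {S : Set (Vertex d × ℕ)} {A : Set (Instructions d)}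
    (hA : MeasurableSet[instrSigma S] A) : MeasurableSet A :=
  instrSigma_le S A hA

/-- The Markov property of driven processes. -/
theorem lintegral_driven_succ [IsProbabilityMeasure (stepLaw d q p)]
    (F : Option (Vertex d) → Step d → Option (Vertex d)) (v : Vertex d) (k : ℕ)
    (f : Option (Vertex d) → ℝ≥0∞) :
    ∫⁻ ω, f (driven F v ω (k + 1)) ∂law d q p
      = ∫⁻ ω, ∑ s, stepLaw d q p {s} * f (F (driven F v ω k) s) ∂law d q p := by
  classical
  -- Split according to the countably many states at time `k` and the finitely many next steps; the
  -- next step is independent of the state.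
  have h1 : ∀ ω : Instructions d, f (driven F v ω (k + 1)) = ∑' o, ∑ s,
      ({ω | driven F v ω k = o} ∩ {ω | ω (v, k) ∈ ({s} : Set (Step d))}).indicator
        (fun _ => f (F o s)) ω := by
    intro ω
    rw [tsum_eq_single (driven F v ω k), Finset.sum_eq_single (ω (v, k))]
    · simp [driven]
    · intro s _ hs
      simp [hs.symm]
    · simp
    · intro o ho
      simp [ho.symm]
  have h2 : ∀ ω : Instructions d, ∑ s, stepLaw d q p {s} * f (F (driven F v ω k) s)
      = ∑' o, {ω | driven F v ω k = o}.indicator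
        (fun _ => ∑ s, stepLaw d q p {s} * f (F o s)) ω := by
    intro ω
    rw [tsum_eq_single (driven F v ω k)]
    · simp
    · intro o ho
      simp [ho.symm]
  have hm (o) : MeasurableSet {ω : Instructions d | driven F v ω k = o} :=
    measurableSet_pi (measurableSet_driven F v k o)
  have hs (s) : MeasurableSet {ω : Instructions d | ω (v, k) ∈ ({s} : Set (Step d))} :=
    measurableSet_pi (measurableSet_instr (Set.mem_singleton (v, k)) {s})
  simp_rw [h1, h2]
  rw [lintegral_tsum fun o => (Finset.measurable_sum _ fun s _ =>
      measurable_const.indicator ((hm o).inter (hs s))).aemeasurable,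
    lintegral_tsum fun o => (measurable_const.indicator (hm o)).aemeasurable]
  refine tsum_congr fun o => ?_
  rw [lintegral_finsetSum _ fun s _ => measurable_const.indicator ((hm o).inter (hs s)),
    lintegral_indicator_const (hm o), Finset.sum_mul]
  refine Finset.sum_congr rfl fun s _ => ?_
  rw [lintegral_indicator_const ((hm o).inter (hs s)),
    measure_inter_step (measurableSet_driven F v k o)]
  ring

theorem lintegral_driven_zero [IsProbabilityMeasure (stepLaw d q p)]
    (F : Option (Vertex d) → Step d → Option (Vertex d)) (v : Vertex d)
    (f : Option (Vertex d) → ℝ≥0∞) :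
    ∫⁻ ω, f (driven F v ω 0) ∂law d q p = f (some v) := by
  simp [driven]

end Foundations

/-! ### Hitting probabilities via super- and subharmonic functions. -/

section Hitting

variable {d : ℕ} {q p : ℝ}

/-- The frog initially at `v`, once activated, visits `z`. -/
def Hits (v z : Vertex d) : Set (Instructions d) := {ω | ∃ k, walk ω v k = some z}

theorem measurableSet_hits (v z : Vertex d) : MeasurableSet[instrSigma (rows {v})] (Hits v z) := by
  have : Hits v z = ⋃ k, {ω | walk ω v k = some z} := by ext ω; simp [Hits]
  rw [this]
  let _ := instrSigma (rows {v})
  exact .iUnion fun k => instrSigma_mono (past_subset_rows v k) _ (measurableSet_walk v k _)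

/-- One step of a walk stopped at `z`. -/
def stoppedStep (z : Vertex d) (o : Option (Vertex d)) (s : Step d) : Option (Vertex d) :=
  if o = some z then some z else o.bind fun x => move x s

/-- Stopping at `z` turns hitting by time `k` into an event about the state at time `k` alone, which
makes the hitting events increasing in `k`. -/
theorem driven_stoppedStep (z v : Vertex d) (ω : Instructions d) (k : ℕ) :
    (driven (stoppedStep z) v ω k = some z ∧ ∃ j ≤ k, walk ω v j = some z) ∨
      (driven (stoppedStep z) v ω k = walk ω v k ∧ ∀ j ≤ k, walk ω v j ≠ some z) := by
  induction k with
  | zero =>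
    by_cases h : v = z
    · left; simp [driven, walk, h]
    · right; simp [driven, walk, h]
  | succ k ih =>
    rcases ih with ⟨h1, j, hj, h2⟩ | ⟨h1, h2⟩
    · exact .inl ⟨by simp [driven, stoppedStep, h1], j, by omega, h2⟩
    · have h3 : driven (stoppedStep z) v ω (k + 1) = walk ω v (k + 1) := by
        simp [driven, stoppedStep, h1, h2 k le_rfl, walk]
      by_cases h : walk ω v (k + 1) = some z
      · exact .inl ⟨h3.trans h, _, le_rfl, h⟩
      · refine .inr ⟨h3, fun j hj => ?_⟩
        rcases Nat.le_succ_iff.1 hj with hj | rfl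
        exacts [h2 j hj, h]

theorem driven_stoppedStep_eq_some_iff (z v : Vertex d) (ω : Instructions d) (k : ℕ) :
    driven (stoppedStep z) v ω k = some z ↔ ∃ j ≤ k, walk ω v j = some z := by
  rcases driven_stoppedStep z v ω k with ⟨h1, h2⟩ | ⟨h1, h2⟩
  · exact iff_of_true h1 h2
  · refine iff_of_false (h1 ▸ h2 k le_rfl) ?_
    rintro ⟨j, hj, h⟩
    exact h2 j hj h

theorem hits_eq_iUnion (v z : Vertex d) :
    Hits v z = ⋃ k, {ω | driven (stoppedStep z) v ω k = some z} := by
  ext ω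
  simp only [Hits, Set.mem_ofPred_eq, Set.mem_iUnion, driven_stoppedStep_eq_some_iff]
  exact ⟨fun ⟨k, h⟩ => ⟨k, k, le_rfl, h⟩, fun ⟨_, k, _, h⟩ => ⟨k, h⟩⟩

/-- The expected value of `φ` after one step from `x`, a dead frog counting `0`. -/
noncomputable def stepMean (d : ℕ) (q p : ℝ) (φ : Vertex d → ℝ≥0∞) (x : Vertex d) : ℝ≥0∞ :=
  ENNReal.ofReal (q * p) * φ x.tail + ∑ i, ENNReal.ofReal (q * ((1 - p) / d)) * φ (i :: x)

theorem stepMean_one (hd : 1 ≤ d) (hq : q ∈ Set.Icc (0 : ℝ) 1) (hp : p ∈ Set.Icc (0 : ℝ) 1)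
    (x : Vertex d) : stepMean d q p (fun _ => 1) x = ENNReal.ofReal q := by
  have hd' : (0 : ℝ) < d := by exact_mod_cast hd
  have h2 : 0 ≤ q * ((1 - p) / d) := mul_nonneg hq.1 (div_nonneg (by linarith [hp.2]) hd'.le)
  simp only [stepMean, mul_one, Finset.sum_const, Finset.card_univ, Fintype.card_fin,
    nsmul_eq_mul]
  rw [← ENNReal.ofReal_natCast, ← ENNReal.ofReal_mul hd'.le,
    ← ENNReal.ofReal_add (mul_nonneg hq.1 hp.1) (by positivity)]
  congr 1
  field_simp
  ring

theorem sum_stoppedStep (φ : Vertex d → ℝ≥0∞) {x z : Vertex d} (h : x ≠ z) :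
    ∑ s, stepLaw d q p {s} * (stoppedStep z (some x) s).elim 0 φ = stepMean d q p φ x := by
  simp [sum_step, stoppedStep, h, move, stepLaw_toRoot, stepLaw_toChild, stepMean]

theorem sum_stoppedStep_self [IsProbabilityMeasure (stepLaw d q p)] (φ : Vertex d → ℝ≥0∞)
    (z : Vertex d) :
    ∑ s, stepLaw d q p {s} * (stoppedStep z (some z) s).elim 0 φ = φ z := by
  simp [stoppedStep, ← Finset.sum_mul]

theorem sum_stoppedStep_none (φ : Vertex d → ℝ≥0∞) (z : Vertex d) :
    ∑ s, stepLaw d q p {s} * (stoppedStep z none s).elim 0 φ = 0 := by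
  simp [stoppedStep]

theorem measure_hits_eq_iSup (v z : Vertex d) : law d q p (Hits v z) =
    ⨆ k, law d q p {ω | driven (stoppedStep z) v ω k = some z} := by
  rw [hits_eq_iUnion]
  refine Monotone.measure_iUnion fun k l hkl ω => ?_
  simp only [Set.mem_ofPred_eq, driven_stoppedStep_eq_some_iff]
  exact fun ⟨j, hj, h⟩ => ⟨j, hj.trans hkl, h⟩

variable [IsProbabilityMeasure (stepLaw d q p)]

/-- A function which is superharmonic off `z` and at least `1` at `z` bounds the probability of
hitting `z` from above. -/
theorem measure_hits_le (φ : Vertex d → ℝ≥0∞) (z : Vertex d) (hz : 1 ≤ φ z)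
    (hφ : ∀ x ≠ z, stepMean d q p φ x ≤ φ x) (v : Vertex d) :
    law d q p (Hits v z) ≤ φ v := by
  have key : ∀ k, ∫⁻ ω, (driven (stoppedStep z) v ω k).elim 0 φ ∂law d q p ≤ φ v := by
    intro k
    induction k with
    | zero => rw [lintegral_driven_zero (f := fun o => o.elim 0 φ)]; rfl
    | succ k ih =>
      rw [lintegral_driven_succ (f := fun o => o.elim 0 φ)]
      refine (lintegral_mono fun ω => ?_).trans ih
      rcases driven (stoppedStep z) v ω k with _ | x
      · rw [sum_stoppedStep_none]; exact le_rfl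
      · by_cases h : x = z
        · rw [h, sum_stoppedStep_self]; exact le_rfl
        · rw [sum_stoppedStep _ h]; exact hφ x h
  rw [measure_hits_eq_iSup]
  refine iSup_le fun k => le_trans ?_ (key k)
  have hm : MeasurableSet {ω : Instructions d | driven (stoppedStep z) v ω k = some z} :=
    measurableSet_pi (measurableSet_driven _ v k _)
  rw [← lintegral_indicator_one hm]
  refine lintegral_mono fun ω => ?_
  by_cases h : driven (stoppedStep z) v ω k = some z
  · simpa [h] using hz
  · simp [h]

/-- A function bounded by `1` which is subharmonic off `z` bounds the probability of hitting `z`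
from below, since the frog dies eventually. -/
theorem le_measure_hits (hd : 1 ≤ d) (hq : q ∈ Set.Ico (0 : ℝ) 1) (hp : p ∈ Set.Icc (0 : ℝ) 1)
    (φ : Vertex d → ℝ≥0∞) (z : Vertex d) (h1 : ∀ x, φ x ≤ 1)
    (hφ : ∀ x ≠ z, φ x ≤ stepMean d q p φ x) (v : Vertex d) :
    φ v ≤ law d q p (Hits v z) := by
  classical
  have key : ∀ k, φ v ≤ ∫⁻ ω, (driven (stoppedStep z) v ω k).elim 0 φ ∂law d q p := by
    intro k
    induction k with
    | zero => rw [lintegral_driven_zero (f := fun o => o.elim 0 φ)]; rfl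
    | succ k ih =>
      rw [lintegral_driven_succ (f := fun o => o.elim 0 φ)]
      refine ih.trans (lintegral_mono fun ω => ?_)
      rcases driven (stoppedStep z) v ω k with _ | x
      · exact zero_le
      · by_cases h : x = z
        · rw [h, sum_stoppedStep_self]; exact le_rfl
        · rw [sum_stoppedStep _ h]; exact hφ x h
  -- `ψ` detects walks that are alive and not yet stopped. Their probability at time `k` is at most
  -- `q ^ k`, which is the error in replacing the mean of `φ` by the probability of having hit `z`.
  set ψ : Vertex d → ℝ≥0∞ := fun x => if x = z then 0 else 1 with hψ
  have alive : ∀ k, ∫⁻ ω, (driven (stoppedStep z) v ω k).elim 0 ψ ∂law d q p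
      ≤ ENNReal.ofReal q ^ k := by
    intro k
    induction k with
    | zero =>
      rw [lintegral_driven_zero (f := fun o => o.elim 0 ψ)]
      simp only [Option.elim, hψ, pow_zero]
      split_ifs <;> simp
    | succ k ih =>
      rw [lintegral_driven_succ (f := fun o => o.elim 0 ψ), pow_succ']
      refine le_trans ?_ (mul_le_mul_right ih _)
      rw [← lintegral_const_mul' _ _ ENNReal.ofReal_ne_top]
      refine lintegral_mono fun ω => ?_
      rcases driven (stoppedStep z) v ω k with _ | x
      · rw [sum_stoppedStep_none]; exact zero_le
      · by_cases h : x = z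
        · rw [h, sum_stoppedStep_self]; simp [hψ]
        · rw [sum_stoppedStep _ h, ← stepMean_one hd ⟨hq.1, hq.2.le⟩ hp x]
          have : (some x).elim 0 ψ = 1 := by simp [hψ, h]
          rw [this, mul_one]
          unfold stepMean
          have hle : ∀ y, ψ y ≤ 1 := fun y => by simp only [hψ]; split_ifs <;> simp
          gcongr <;> exact hle _
  have bound : ∀ k, φ v ≤ law d q p (Hits v z) + ENNReal.ofReal q ^ k := by
    intro k
    have hm : MeasurableSet {ω : Instructions d | driven (stoppedStep z) v ω k = some z} :=
      measurableSet_pi (measurableSet_driven _ v k _)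
    calc φ v ≤ ∫⁻ ω, (driven (stoppedStep z) v ω k).elim 0 φ ∂law d q p := key k
      _ ≤ ∫⁻ ω, ({ω | driven (stoppedStep z) v ω k = some z}.indicator 1 ω +
            (driven (stoppedStep z) v ω k).elim 0 ψ) ∂law d q p := by
          refine lintegral_mono fun ω => ?_
          by_cases h : driven (stoppedStep z) v ω k = some z
          · simpa [h] using (h1 z).trans le_self_add
          · rcases h' : driven (stoppedStep z) v ω k with _ | x
            · simp
            · have : x ≠ z := fun e => h (by rw [h', e])
              simp [h', this, h1, hψ]
      _ = law d q p {ω | driven (stoppedStep z) v ω k = some z} +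
            ∫⁻ ω, (driven (stoppedStep z) v ω k).elim 0 ψ ∂law d q p := by
          rw [lintegral_add_left (measurable_one.indicator hm), lintegral_indicator_one hm]
      _ ≤ _ := by
          refine add_le_add (measure_mono ?_) (alive k)
          rw [hits_eq_iUnion]
          exact Set.subset_iUnion (fun k => {ω | driven (stoppedStep z) v ω k = some z}) k
  have lim : Filter.Tendsto (fun k => law d q p (Hits v z) + ENNReal.ofReal q ^ k) Filter.atTop
      (nhds (law d q p (Hits v z) + 0)) :=
    tendsto_const_nhds.add (ENNReal.tendsto_pow_atTop_nhds_zero_of_lt_one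
      (by rw [← ENNReal.ofReal_one]; exact (ENNReal.ofReal_lt_ofReal_iff one_pos).2 hq.2))
  rw [add_zero] at lim
  exact ge_of_tendsto' lim bound

end Hitting

/-! ### Weak drift: finitely many frogs could ever reach the root. -/

section WeakDrift

variable {d : ℕ} {q p : ℝ}

theorem Recurrent.infinite_hits {ω : Instructions d} (h : Recurrent ω) :
    {v : Vertex d | ω ∈ Hits v []}.Infinite := by
  refine Set.Infinite.mono ?_ h
  rintro v ⟨_, k, _, hk⟩
  exact ⟨k, hk⟩

theorem tsum_list_eq_tsum_vector {α : Type*} (f : List α → ℝ≥0∞) :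
    ∑' l, f l = ∑' n, ∑' l : List.Vector α n, f l.1 := by
  rw [← (Equiv.sigmaFiberEquiv (List.length : List α → ℕ)).tsum_eq f, ENNReal.tsum_sigma']
  rfl

theorem recurrenceProb_eq_zero_of_ae {q p : ℝ} (h : ∀ᵐ ω ∂law d q p, ¬ Recurrent ω) :
    recurrenceProb d q p = 0 := by
  have : law d q p {ω | Recurrent ω} = 0 := by simpa [ae_iff] using h
  simp [recurrenceProb, measureReal_def, this]

theorem stepMean_pow_length_le (hd : 1 ≤ d) (hq : 0 ≤ q) (hp : p ∈ Set.Icc (0 : ℝ) 1) {x : ℝ}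
    (hx : 0 ≤ x) (hx2 : q * p + q * (1 - p) * x ^ 2 ≤ x) {y : Vertex d} (hy : y ≠ []) :
    stepMean d q p (fun y => ENNReal.ofReal (x ^ y.length)) y ≤ ENNReal.ofReal (x ^ y.length) := by
  obtain ⟨a, t, rfl⟩ := List.exists_cons_of_ne_nil hy
  have hd' : (0 : ℝ) < d := by exact_mod_cast hd
  have h1p : 0 ≤ 1 - p := by linarith [hp.2]
  have h2 : 0 ≤ q * ((1 - p) / d) := by positivity
  have h3 : 0 ≤ q * p := mul_nonneg hq hp.1
  simp only [stepMean, List.tail_cons, List.length_cons, Finset.sum_const, Finset.card_univ,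
    Fintype.card_fin, nsmul_eq_mul]
  rw [← ENNReal.ofReal_mul h3, ← ENNReal.ofReal_mul h2, ← ENNReal.ofReal_natCast,
    ← ENNReal.ofReal_mul hd'.le, ← ENNReal.ofReal_add (by positivity) (by positivity)]
  refine ENNReal.ofReal_le_ofReal ?_
  calc q * p * x ^ t.length + d * (q * ((1 - p) / d) * x ^ (t.length + 1 + 1))
      = x ^ t.length * (q * p + q * (1 - p) * x ^ 2) := by field_simp; ring
    _ ≤ x ^ t.length * x := by gcongr
    _ = x ^ (t.length + 1) := by ring

/-- The inequality is strict at `x = 1 / d`, by the bound on `p` together with `q < 1`; continuity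
leaves room slightly to the left. -/
theorem exists_decay_lt_inv (hd : 2 ≤ d) (hq : q ∈ Set.Ioo (0 : ℝ) 1)
    (hpd : p < 1 / (1 + q * d)) :
    ∃ x : ℝ, 0 < x ∧ x < 1 / d ∧ q * p + q * (1 - p) * x ^ 2 ≤ x := by
  obtain ⟨hq0, hq1⟩ := hq
  have hd' : (2 : ℝ) ≤ d := by exact_mod_cast hd
  have hd0 : (0 : ℝ) < d := by linarith
  have hlt : q * p + q * (1 - p) * (1 / d) ^ 2 < 1 / d := by
    rw [lt_div_iff₀ (by positivity)] at hpd
    have h1 : q * p * d ^ 2 + q * (1 - p) < d := by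
      have hpos : (0 : ℝ) < 1 + q * d := by positivity
      -- After multiplication by `1 + q * d`, the bound on `p` reduces the claim to `q * q * d < d`.
      refine lt_of_mul_lt_mul_right ?_ hpos.le
      have h2 : q * (d ^ 2 - 1) * (p * (1 + q * d)) ≤ q * (d ^ 2 - 1) * 1 :=
        mul_le_mul_of_nonneg_left hpd.le (mul_nonneg hq0.le (by nlinarith))
      have h3 : q * q * d ≤ 1 * 1 * d := by gcongr
      have h4 : q * q * d < d := by nlinarith
      nlinarith
    have : q * p + q * (1 - p) * (1 / d) ^ 2 = (q * p * d ^ 2 + q * (1 - p)) / d ^ 2 := by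
      field_simp
    rw [this, div_lt_div_iff₀ (by positivity) hd0]
    nlinarith
  have hcont : ContinuousAt (fun x : ℝ => q * p + q * (1 - p) * x ^ 2 - x) (1 / d) := by fun_prop
  have hev := hcont.eventually_lt continuousAt_const
    (show q * p + q * (1 - p) * (1 / (d : ℝ)) ^ 2 - 1 / d < 0 by linarith)
  obtain ⟨x, hx1, hx2⟩ := ((hev.filter_mono nhdsWithin_le_nhds).and
    (Ioo_mem_nhdsLT (show (0 : ℝ) < 1 / d by positivity))).exists
  exact ⟨x, hx2.1, hx2.2, by linarith⟩

theorem recurrenceProb_eq_zero_of_lt (hd : 2 ≤ d) (hq : q ∈ Set.Ioo (0 : ℝ) 1)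
    (hp : p ∈ Set.Icc (0 : ℝ) 1) (hpd : p < 1 / (1 + q * d)) : recurrenceProb d q p = 0 := by
  have := isProbabilityMeasure_stepLaw (d := d) (by omega) ⟨hq.1.le, hq.2.le⟩ hp
  obtain ⟨x, hx0, hxd, hx⟩ := exists_decay_lt_inv hd hq hpd
  have hd0 : (0 : ℝ) < d := by exact_mod_cast (by omega : 0 < d)
  have hle (v : Vertex d) : law d q p (Hits v []) ≤ ENNReal.ofReal (x ^ v.length) :=
    measure_hits_le (fun y => ENNReal.ofReal (x ^ y.length)) [] (by simp)
      (fun y hy => stepMean_pow_length_le (by omega) hq.1.le hp hx0.le hx hy) v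
  have hsum : ∑' v : Vertex d, law d q p (Hits v []) ≠ ∞ := by
    refine ne_top_of_le_ne_top ?_ (ENNReal.tsum_le_tsum hle)
    -- Level `n` has `d ^ n` vertices, each contributing `x ^ n`.
    have h1 : ∀ n, ∑' l : List.Vector (Fin d) n, ENNReal.ofReal (x ^ l.1.length)
        = ENNReal.ofReal ((d * x) ^ n) := by
      intro n
      have : ∀ l : List.Vector (Fin d) n, ENNReal.ofReal (x ^ l.1.length)
          = ENNReal.ofReal (x ^ n) := fun l => by rw [l.2]
      simp_rw [this]
      rw [tsum_fintype, Finset.sum_const, Finset.card_univ, card_vector, Fintype.card_fin,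
        nsmul_eq_mul, mul_pow, ENNReal.ofReal_mul (by positivity), ← Nat.cast_pow,
        ENNReal.ofReal_natCast]
    rw [tsum_list_eq_tsum_vector]
    simp_rw [h1]
    refine (summable_geometric_of_lt_one (by positivity) ?_).tsum_ofReal_ne_top
    rwa [mul_comm, ← lt_div_iff₀ hd0]
  refine recurrenceProb_eq_zero_of_ae ?_
  filter_upwards [ae_finite_setOfPred_mem hsum] with ω hω hrec
  exact hrec.infinite_hits hω

end WeakDrift

/-! ### Strong drift: discoveries of one frog and chains of discoveries. -/

section StrongDrift

variable {d : ℕ} {q p : ℝ}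

/-- The vertices on the geodesic from the root to the position of a walk have been visited, unless
they lie above the starting point. -/
theorem visited_of_suffix {ω : Instructions d} {u x w : Vertex d} {k : ℕ}
    (hx : walk ω u k = some x) (hw : w <:+ x) : w <:+ u ∨ ∃ j ≤ k, walk ω u j = some w := by
  induction k generalizing x with
  | zero =>
    obtain rfl : u = x := by simpa [walk] using hx
    exact .inl hw
  | succ k ih =>
    have hx' := hx
    rw [walk, Option.bind_eq_some_iff] at hx
    obtain ⟨y, hy, hm⟩ := hx
    have of_y (h : w <:+ y) : w <:+ u ∨ ∃ j ≤ k + 1, walk ω u j = some w :=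
      (ih hy h).imp_right fun ⟨j, hj, h⟩ => ⟨j, by omega, h⟩
    cases hs : ω (u, k) with
    | die => simp [hs, move] at hm
    | toRoot =>
      obtain rfl : y.tail = x := by simpa [hs, move] using hm
      exact of_y (hw.trans (List.tail_suffix y))
    | toChild i =>
      obtain rfl : i :: y = x := by simpa [hs, move] using hm
      rcases List.suffix_cons_iff.1 hw with rfl | h
      exacts [.inr ⟨_, le_rfl, hx'⟩, of_y h]

/-- The frog initially at `u`, once activated, visits `v`, which is neither `u` nor an ancestor
of `u`. -/
def Discovers (u v : Vertex d) : Set (Instructions d) := {ω | ω ∈ Hits u v ∧ ¬ v <:+ u}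

theorem measurableSet_discovers (u v : Vertex d) :
    MeasurableSet[instrSigma (rows {u})] (Discovers u v) := by
  let _ := instrSigma (rows {u})
  exact (measurableSet_hits u v).inter (.const _)

/-- The frog initially at `u` starts by moving to its child `i`, back, and again to `i`. -/
def Backtracks (i : Fin d) (u : Vertex d) : Set (Instructions d) :=
  {ω | ω (u, 0) = .toChild i ∧ ω (u, 1) = .toRoot ∧ ω (u, 2) = .toChild i}

/-- The frog initially at `u` moves to a child at the `(k + 1)`-st step, except for the third step
of a walk that backtracks. -/
def Descends (i : Fin d) (u : Vertex d) (k : ℕ) : Set (Instructions d) :=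
  {ω | walk ω u k ≠ none ∧ ω (u, k) ∈ Set.range .toChild ∧ (k = 2 → ω ∉ Backtracks i u)}

/-- Consider the first visit to `v`. It cannot be made by a step towards the root, since a walk
started outside the subtree of `v` enters that subtree through `v`. Nor is it the third step of a
backtracking walk, which returns to a vertex already visited at time `1`. -/
theorem exists_descends_of_discovers {ω : Instructions d} {u v : Vertex d} (i : Fin d)
    (h : ω ∈ Discovers u v) : ∃ k, walk ω u (k + 1) = some v ∧ ω ∈ Descends i u k := by
  classical
  obtain ⟨hv, hsuf⟩ := h
  have hv' : ∃ k, walk ω u k = some v := hv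
  have hmin := fun m => Nat.find_min (m := m) hv'
  have hk := Nat.find_spec hv'
  generalize Nat.find hv' = k at hk hmin
  obtain _ | k := k
  · obtain rfl : u = v := by simpa [walk] using hk
    exact absurd List.suffix_rfl hsuf
  have hk' := hk
  rw [walk, Option.bind_eq_some_iff] at hk
  obtain ⟨x, hx, hm⟩ := hk
  refine ⟨k, hk', by simp [hx], ?_, ?_⟩
  · cases hs : ω (u, k) with
    | die => simp [hs, move] at hm
    | toRoot =>
      obtain rfl : x.tail = v := by simpa [hs, move] using hm
      rcases visited_of_suffix hx (List.tail_suffix x) with h | ⟨j, hj, h⟩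
      · exact absurd h hsuf
      · exact absurd h (hmin j (by omega))
    | toChild i => exact ⟨i, rfl⟩
  · rintro rfl ⟨h0, h1, h2⟩
    refine hmin 1 (by omega) (Eq.trans ?_ hk')
    simp [walk, h0, h1, h2, move]

variable [IsProbabilityMeasure (stepLaw d q p)]

theorem measure_alive (hd : 1 ≤ d) (hq : 0 ≤ q) (hp : p ∈ Set.Icc (0 : ℝ) 1) (u : Vertex d)
    (k : ℕ) : law d q p {ω | walk ω u k ≠ none} = ENNReal.ofReal q ^ k := by
  induction k with
  | zero => simp [walk]
  | succ k ih =>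
    have : {ω : Instructions d | walk ω u (k + 1) ≠ none}
        = {ω | walk ω u k = none}ᶜ ∩ {ω | ω (u, k) ∈ ({.die}ᶜ : Set (Step d))} := by
      ext ω
      rcases h : walk ω u k with _ | x
      · simp [walk, h]
      · cases hs : ω (u, k) <;> simp [walk, h, hs, move]
    rw [this, measure_inter_step (measurableSet_walk u k none).compl, stepLaw_compl_die hq hp hd,
      pow_succ, ← ih]
    rfl

theorem measure_alive_inter_child (hd : 1 ≤ d) (hq : 0 ≤ q) (hp : p ∈ Set.Icc (0 : ℝ) 1)
    (u : Vertex d) (k : ℕ) :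
    law d q p ({ω | walk ω u k ≠ none} ∩ {ω | ω (u, k) ∈ Set.range .toChild})
      = ENNReal.ofReal (q ^ k * (q * (1 - p))) := by
  rw [ENNReal.ofReal_mul (by positivity), ENNReal.ofReal_pow hq, ← measure_alive hd hq hp u k,
    ← stepLaw_range_toChild hq hp hd]
  exact measure_inter_step (measurableSet_walk u k none).compl _

theorem backtracks_eq (i : Fin d) (u : Vertex d) : Backtracks i u =
    ({ω | ω (u, 0) ∈ ({.toChild i} : Set (Step d))} ∩ {ω | ω (u, 1) ∈ ({.toRoot} : Set (Step d))}) ∩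
      {ω | ω (u, 2) ∈ ({.toChild i} : Set (Step d))} := by
  ext ω
  simp [Backtracks, and_assoc]

theorem measurableSet_backtracks (i : Fin d) (u : Vertex d) : MeasurableSet (Backtracks i u) := by
  rw [backtracks_eq]
  exact ((measurableSet_pi (measurableSet_instr (Set.mem_singleton _) _)).inter
    (measurableSet_pi (measurableSet_instr (Set.mem_singleton _) _))).inter
    (measurableSet_pi (measurableSet_instr (Set.mem_singleton _) _))

theorem measure_backtracks (hq : 0 ≤ q) (hp : p ∈ Set.Icc (0 : ℝ) 1) (i : Fin d) (u : Vertex d) :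
    law d q p (Backtracks i u) = ENNReal.ofReal
      (q * ((1 - p) / d) * (q * p) * (q * ((1 - p) / d))) := by
  have h1p : 0 ≤ 1 - p := by linarith [hp.2]
  have h2 : 0 ≤ q * ((1 - p) / d) := by positivity
  have h3 : 0 ≤ q * p := mul_nonneg hq hp.1
  have m0 (k : ℕ) (hk : 0 < k) : MeasurableSet[instrSigma (past u k)]
      {ω : Instructions d | ω (u, 0) ∈ ({.toChild i} : Set (Step d))} :=
    measurableSet_instr (show (u, 0) ∈ past u k from ⟨rfl, hk⟩) _
  have m1 : MeasurableSet[instrSigma (past u 2)]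
      {ω : Instructions d | ω (u, 1) ∈ ({.toRoot} : Set (Step d))} :=
    measurableSet_instr (show (u, 1) ∈ past u 2 from ⟨rfl, Nat.lt_succ_self 1⟩) _
  rw [backtracks_eq, measure_inter_step (@MeasurableSet.inter _ (instrSigma (past u 2)) _ _
      (m0 2 two_pos) m1), measure_inter_step (m0 1 one_pos), law_instr, stepLaw_toChild,
    stepLaw_toRoot, ← ENNReal.ofReal_mul h2, ← ENNReal.ofReal_mul (by positivity)]

theorem measurableSet_descends (i : Fin d) (u : Vertex d) (k : ℕ) :
    MeasurableSet (Descends i u k) := by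
  have : Descends i u k = {ω | walk ω u k = none}ᶜ ∩ ({ω | ω (u, k) ∈ Set.range .toChild} ∩
      {ω | k = 2 → ω ∉ Backtracks i u}) := rfl
  rw [this]
  refine (measurableSet_pi (measurableSet_walk u k none).compl).inter
    ((measurableSet_pi (measurableSet_instr (Set.mem_singleton (u, k)) _)).inter ?_)
  exact (MeasurableSet.const (k = 2)).imp (measurableSet_backtracks i u).compl

theorem measure_descends_le (hd : 1 ≤ d) (hq : 0 ≤ q) (hp : p ∈ Set.Icc (0 : ℝ) 1) (i : Fin d)
    (u : Vertex d) (k : ℕ) :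
    law d q p (Descends i u k) ≤ ENNReal.ofReal (q ^ k * (q * (1 - p)) -
      if k = 2 then q * ((1 - p) / d) * (q * p) * (q * ((1 - p) / d)) else 0) := by
  have h1p : 0 ≤ 1 - p := by linarith [hp.2]
  have h3 : 0 ≤ q * p := mul_nonneg hq hp.1
  have hsub : Descends i u k ⊆
      {ω | walk ω u k ≠ none} ∩ {ω | ω (u, k) ∈ Set.range .toChild} := fun ω h => ⟨h.1, h.2.1⟩
  split_ifs with hk
  · subst hk
    -- A backtracking walk is alive after two steps and then moves to a child, so `Backtracks` is a
    -- part of the larger event disjoint from `Descends`.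
    rw [ENNReal.ofReal_sub _ (by positivity), ← measure_alive_inter_child hd hq hp u,
      ← measure_backtracks hq hp i u]
    refine ENNReal.le_sub_of_add_le_right (measure_ne_top _ _) ?_
    rw [← measure_union _ (measurableSet_backtracks i u)]
    · refine measure_mono (Set.union_subset hsub fun ω h => ⟨?_, i, h.2.2.symm⟩)
      simp [walk, h.1, h.2.1, move]
    · exact Set.disjoint_left.2 fun ω h h' => h.2.2 rfl h'
  · rw [sub_zero, ← measure_alive_inter_child hd hq hp u]
    exact measure_mono hsub

/-- An upper bound for the expected number of discoveries of a frog. -/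
noncomputable def discoveryMean (d : ℕ) (q p : ℝ) : ℝ :=
  (1 - q)⁻¹ * (q * (1 - p)) - q * ((1 - p) / d) * (q * p) * (q * ((1 - p) / d))

theorem tsum_measure_discovers_le (hd : 1 ≤ d) (hq : q ∈ Set.Ico (0 : ℝ) 1)
    (hp : p ∈ Set.Icc (0 : ℝ) 1) (u : Vertex d) :
    ∑' v, law d q p (Discovers u v) ≤ ENNReal.ofReal (discoveryMean d q p) := by
  have hd' : (1 : ℝ) ≤ d := by exact_mod_cast hd
  have h1p : 0 ≤ 1 - p := by linarith [hp.2]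
  have hq0 := hq.1
  have hp0 := hp.1
  let i : Fin d := ⟨0, by omega⟩
  have hwalk (v k) : MeasurableSet {ω : Instructions d | walk ω u (k + 1) = some v} :=
    measurableSet_pi (measurableSet_walk u (k + 1) _)
  have h1 (v) : law d q p (Discovers u v)
      ≤ ∑' k, law d q p ({ω | walk ω u (k + 1) = some v} ∩ Descends i u k) := by
    refine (measure_mono fun ω hω => ?_).trans (measure_iUnion_le _)
    obtain ⟨k, hk⟩ := exists_descends_of_discovers i hω
    exact Set.mem_iUnion.2 ⟨k, hk⟩
  -- The position at time `k + 1` is unique, so these events are disjoint as `v` varies.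
  have h2 (k) : ∑' v, law d q p ({ω | walk ω u (k + 1) = some v} ∩ Descends i u k)
      ≤ law d q p (Descends i u k) := by
    rw [← measure_iUnion]
    · exact measure_mono (Set.iUnion_subset fun v => Set.inter_subset_right)
    · intro v w hvw
      refine Set.disjoint_left.2 fun ω h h' => hvw ?_
      have := h.1.symm.trans h'.1
      simpa using this
    · exact fun v => (hwalk v k).inter (measurableSet_descends i u k)
  have hs : HasSum (fun k => q ^ k * (q * (1 - p)) -
      if k = 2 then q * ((1 - p) / d) * (q * p) * (q * ((1 - p) / d)) else 0)
      (discoveryMean d q p) :=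
    ((hasSum_geometric_of_lt_one hq.1 hq.2).mul_right _).sub (hasSum_ite_eq 2 _)
  refine (ENNReal.tsum_le_tsum h1).trans ?_
  rw [ENNReal.tsum_comm]
  refine (ENNReal.tsum_le_tsum fun k => (h2 k).trans
    (measure_descends_le hd hq.1 hp i u k)).trans ?_
  rw [← hs.tsum_eq, ENNReal.ofReal_tsum_of_nonneg _ hs.summable]
  intro k
  split_ifs with hk
  · subst hk
    have ha : (1 - p) / d ≤ 1 - p := div_le_self h1p hd'
    have hb : (1 - p) / d ≤ 1 := ha.trans (by linarith)
    have hc : 0 ≤ (1 - p) / d := by positivity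
    have : q * ((1 - p) / d) * (q * p) * (q * ((1 - p) / d)) ≤ q * (1 - p) * (q * 1) * (q * 1) := by
      gcongr
      exact hp.2
    linarith
  · rw [sub_zero]
    positivity

/-- A list of vertices, starting with the last one and ending with the root, each of which is
discovered by the frog initially at the preceding vertex. -/
def Genealogy : List (Vertex d) → Set (Instructions d)
  | [] => ∅
  | [v] => {_ω | v = []}
  | v :: u :: l => {ω | u ∉ l ∧ ω ∈ Genealogy (u :: l) ∧ ω ∈ Discovers u v}

theorem measurableSet_genealogy (v : Vertex d) (l : List (Vertex d)) :
    MeasurableSet[instrSigma (rows {w | w ∈ l})] (Genealogy (v :: l)) := by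
  induction l generalizing v with
  | nil => exact @MeasurableSet.const _ (instrSigma _) _
  | cons u l ih =>
    let _ := instrSigma (rows {w | w ∈ u :: l})
    refine (MeasurableSet.const _).inter (.inter ?_ ?_)
    · exact instrSigma_mono (rows_mono fun w hw => List.mem_cons_of_mem _ hw) _ (ih u)
    · exact instrSigma_mono (rows_mono fun w hw => hw ▸ List.mem_cons_self) _
        (measurableSet_discovers u v)

/-- The chain ending at `u` uses only the frogs in `l`, and the discovery of `v` only the frog of
`u`; the condition `u ∉ l` makes the two independent. -/
theorem measure_genealogy_cons_le (v u : Vertex d) (l : List (Vertex d)) :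
    law d q p (Genealogy (v :: u :: l))
      ≤ law d q p (Genealogy (u :: l)) * law d q p (Discovers u v) := by
  by_cases h : u ∈ l
  · have : Genealogy (v :: u :: l) = ∅ := by
      ext ω
      simp [Genealogy, h]
    simp [this]
  · rw [← measure_inter_of_disjoint (disjoint_rows _) (measurableSet_genealogy u l)
      (measurableSet_discovers u v)]
    · exact measure_mono fun ω hω => hω.2
    · simpa using h

/-- The first-moment bound for generation `n` of a branching process. -/
theorem tsum_measure_genealogy_le (hd : 1 ≤ d) (hq : q ∈ Set.Ico (0 : ℝ) 1)
    (hp : p ∈ Set.Icc (0 : ℝ) 1) (n : ℕ) :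
    ∑' l : List.Vector (Vertex d) (n + 1), law d q p (Genealogy l.1)
      ≤ ENNReal.ofReal (discoveryMean d q p) ^ n := by
  induction n with
  | zero =>
    rw [tsum_eq_single ⟨[[]], rfl⟩, pow_zero]
    · exact prob_le_one
    · rintro ⟨l, hl⟩ hne
      obtain ⟨v, rfl⟩ := List.length_eq_one_iff.1 hl
      have hv : v ≠ [] := by
        rintro rfl
        exact hne rfl
      simp [Genealogy, hv]
  | succ n ih =>
    let f : Vertex d × List.Vector (Vertex d) (n + 1) → ℝ≥0∞ :=
      fun x => law d q p (Genealogy (x.1 :: x.2.1))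
    have hinj : Function.Injective
        (fun l : List.Vector (Vertex d) (n + 2) => (l.head, l.tail)) := by
      intro l l' h
      rw [← List.Vector.cons_head_tail l, ← List.Vector.cons_head_tail l']
      simp only [Prod.mk.injEq] at h
      rw [h.1, h.2]
    calc ∑' l : List.Vector (Vertex d) (n + 2), law d q p (Genealogy l.1)
        = ∑' l : List.Vector (Vertex d) (n + 2), f (l.head, l.tail) := by
          refine tsum_congr fun l => ?_
          conv_lhs => rw [← List.Vector.cons_head_tail l]
          rfl
      _ ≤ ∑' x, f x := ENNReal.tsum_comp_le_tsum_of_injective hinj f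
      _ = ∑' l : List.Vector (Vertex d) (n + 1), ∑' v, f (v, l) := by
          rw [ENNReal.tsum_prod', ENNReal.tsum_comm]
      _ ≤ ∑' l : List.Vector (Vertex d) (n + 1),
            law d q p (Genealogy l.1) * ENNReal.ofReal (discoveryMean d q p) := by
          refine ENNReal.tsum_le_tsum fun l => ?_
          obtain ⟨_ | ⟨u, l⟩, hl⟩ := l
          · simp at hl
          calc ∑' v, f (v, ⟨u :: l, hl⟩)
              ≤ ∑' v, law d q p (Genealogy (u :: l)) * law d q p (Discovers u v) :=
                ENNReal.tsum_le_tsum fun v => measure_genealogy_cons_le v u l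
            _ ≤ _ := by
                rw [ENNReal.tsum_mul_left]
                exact mul_le_mul_right (tsum_measure_discovers_le hd hq hp u) _
      _ ≤ _ := by
          rw [ENNReal.tsum_mul_right, pow_succ]
          exact mul_le_mul_left ih _

end StrongDrift

/-! ### Activated vertices have genealogies; transience for strong drift. -/

section Activation

variable {d : ℕ} {q p : ℝ} {ω : Instructions d}

theorem age_succ_of_eq_some {t k : ℕ} {v : Vertex d} (h : age ω t v = some k) :
    age ω (t + 1) v = some (k + 1) := by
  simp [age, h]

theorem age_succ_ne_none {t : ℕ} {v : Vertex d} (h : age ω t v ≠ none) :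
    age ω (t + 1) v ≠ none := by
  obtain ⟨k, hk⟩ := Option.ne_none_iff_exists'.1 h
  simp [age_succ_of_eq_some hk]

theorem age_succ_of_visit {t k : ℕ} {u v : Vertex d} (hu : age ω t u = some k)
    (hv : walk ω u (k + 1) = some v) : age ω (t + 1) v ≠ none := by
  rcases h : age ω t v with _ | l
  · have : ∃ u k, age ω t u = some k ∧ walk ω u (k + 1) = some v := ⟨u, k, hu, hv⟩
    simp [age, h, this]
  · simp [age_succ_of_eq_some h]

theorem exists_activator {t : ℕ} {v : Vertex d} (h : age ω t v = none)
    (h' : age ω (t + 1) v ≠ none) :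
    age ω (t + 1) v = some 0 ∧ ∃ u k, age ω t u = some k ∧ walk ω u (k + 1) = some v := by
  by_cases he : ∃ u k, age ω t u = some k ∧ walk ω u (k + 1) = some v
  · exact ⟨by simp only [age, h, he, if_true], he⟩
  · simp only [age, h, he, if_false, ne_eq, not_true_eq_false] at h'

theorem age_ne_none_of_walk {t k j : ℕ} {u w : Vertex d} (hu : age ω t u = some k) (hj : j ≤ k)
    (hw : walk ω u j = some w) : age ω t w ≠ none := by
  induction t generalizing k j with
  | zero =>
    by_cases h : u = []
    · obtain rfl : 0 = k := by simpa [age, h] using hu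
      obtain rfl : j = 0 := by omega
      obtain rfl : u = w := by simpa [walk] using hw
      simp [hu]
    · simp [age, h] at hu
  | succ t ih =>
    rcases h : age ω t u with _ | l
    · obtain rfl : 0 = k := by
        simpa [hu] using (exists_activator h (by simp [hu])).1.symm
      obtain rfl : j = 0 := by omega
      obtain rfl : u = w := by simpa [walk] using hw
      simp [hu]
    · obtain rfl : l + 1 = k := by simpa [age_succ_of_eq_some h] using hu
      rcases Nat.le_succ_iff.1 hj with hj | rfl
      · exact age_succ_ne_none (ih h hj hw)
      · exact age_succ_of_visit h hw

/-- The activated set is closed under ancestors, so a vertex newly woken by `u` is never an ancestor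
of `u` and counts as discovered. -/
theorem age_ne_none_of_suffix {t : ℕ} {v w : Vertex d} (hv : age ω t v ≠ none) (hw : w <:+ v) :
    age ω t w ≠ none := by
  induction t generalizing v w with
  | zero =>
    by_cases h : v = []
    · subst h
      rwa [List.suffix_nil.1 hw]
    · simp [age, h] at hv
  | succ t ih =>
    rcases h : age ω t v with _ | l
    · obtain ⟨-, u, k, hu, hk⟩ := exists_activator h hv
      rcases visited_of_suffix hk hw with h' | ⟨j, hj, h'⟩
      · exact age_succ_ne_none (ih (by simp [hu]) h')
      · exact age_ne_none_of_walk (age_succ_of_eq_some hu) hj h'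
    · exact age_succ_ne_none (ih (by simp [h]) hw)

/-- The last two conclusions carry the induction: a newly woken vertex was asleep while its whole
chain was already awake, so no vertex repeats. -/
theorem exists_genealogy {t : ℕ} {v : Vertex d} (hv : age ω t v ≠ none) :
    ∃ l, ω ∈ Genealogy (v :: l) ∧ v ∉ l ∧ ∀ w ∈ l, age ω t w ≠ none := by
  induction t generalizing v with
  | zero =>
    by_cases h : v = []
    · exact ⟨[], h, by simp, by simp⟩
    · simp [age, h] at hv
  | succ t ih =>
    rcases h : age ω t v with _ | l
    · obtain ⟨-, u, k, hu, hk⟩ := exists_activator h hv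
      have hu' : age ω t u ≠ none := by simp [hu]
      obtain ⟨l, hl, hul, hal⟩ := ih hu'
      have hal' : ∀ w ∈ u :: l, age ω t w ≠ none := by
        simpa using And.intro hu' hal
      exact ⟨u :: l, ⟨hul, hl, ⟨k + 1, hk⟩, fun hs => age_ne_none_of_suffix hu' hs h⟩,
        fun hm => hal' v hm h, fun w hw => age_succ_ne_none (hal' w hw)⟩
    · obtain ⟨l, hl, hvl, hal⟩ := ih (v := v) (by simp [h])
      exact ⟨l, hl, hvl, fun w hw => age_succ_ne_none (hal w hw)⟩

theorem Recurrent.infinite_genealogy (h : Recurrent ω) :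
    {l : List (Vertex d) | ω ∈ Genealogy l}.Infinite := by
  have hex : ∀ v ∈ {v : Vertex d | ∃ t, ActiveAt ω t v []}, ∃ l, ω ∈ Genealogy (v :: l) := by
    rintro v ⟨t, k, hk, -⟩
    obtain ⟨l, hl, -⟩ := exists_genealogy (ω := ω) (t := t) (v := v) (by simp [hk])
    exact ⟨l, hl⟩
  choose! f hf using hex
  exact Set.infinite_of_injOn_mapsTo (f := fun v => v :: f v)
    (fun v _ w _ hvw => (List.cons.inj hvw).1) hf h

theorem discoveryMean_lt_one (hd : 1 ≤ d) (hq : q ∈ Set.Ioo (0 : ℝ) 1)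
    (hp : p ∈ Set.Icc (0 : ℝ) 1) (hp0 : 0 < p) (hqp : q * (1 - p) ≤ 1 - q) :
    discoveryMean d q p < 1 := by
  have hd' : (0 : ℝ) < d := by exact_mod_cast hd
  have hq0 := hq.1
  have hq1 : 0 < 1 - q := by linarith [hq.2]
  unfold discoveryMean
  rcases hp.2.eq_or_lt with rfl | hp1
  -- For `p = 1` there are no steps to children and the mean is `0`; otherwise backtracking has
  -- positive probability, which gives strictness even when the geometric sum equals `1`.
  · simp
  · have h1p : 0 < 1 - p := by linarith
    have h1 : (1 - q)⁻¹ * (q * (1 - p)) ≤ 1 := by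
      rw [inv_mul_le_iff₀ hq1]
      linarith
    have : 0 < q * ((1 - p) / d) * (q * p) * (q * ((1 - p) / d)) := by positivity
    linarith

theorem recurrenceProb_eq_zero_of_le (hd : 1 ≤ d) (hq : q ∈ Set.Ioo (0 : ℝ) 1)
    (hp : p ∈ Set.Icc (0 : ℝ) 1) (hp0 : 0 < p) (hqp : 2 - q⁻¹ ≤ p) :
    recurrenceProb d q p = 0 := by
  have := isProbabilityMeasure_stepLaw (d := d) hd ⟨hq.1.le, hq.2.le⟩ hp
  have hqp' : q * (1 - p) ≤ 1 - q := by
    have h1 := mul_le_mul_of_nonneg_left hqp hq.1.le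
    rw [mul_sub, mul_inv_cancel₀ hq.1.ne'] at h1
    linarith
  have hlt := discoveryMean_lt_one hd hq hp hp0 hqp'
  have hsum : ∑' l : List (Vertex d), law d q p (Genealogy l) ≠ ∞ := by
    rw [tsum_list_eq_tsum_vector, tsum_eq_zero_add' ENNReal.summable]
    refine ENNReal.add_ne_top.2 ⟨?_, ?_⟩
    · have : ∀ l : List.Vector (Vertex d) 0, law d q p (Genealogy l.1) = 0 := by
        rintro ⟨l, hl⟩
        simp [List.length_eq_zero_iff.1 hl, Genealogy]
      simp [this]
    · refine ne_top_of_le_ne_top ?_ (ENNReal.tsum_le_tsum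
        (tsum_measure_genealogy_le hd ⟨hq.1.le, hq.2⟩ hp))
      rw [ENNReal.tsum_geometric, ENNReal.inv_ne_top, Ne, tsub_eq_zero_iff_le, not_le]
      exact ENNReal.ofReal_lt_one.2 hlt
  refine recurrenceProb_eq_zero_of_ae ?_
  filter_upwards [ae_finite_setOfPred_mem hsum] with ω hω hrec
  exact hrec.infinite_genealogy hω

end Activation

/-! ### Lower bounds for hitting probabilities along geodesics. -/

section HittingLowerBounds

variable {d : ℕ} {q p g h : ℝ}

theorem stepMean_ofReal (hq : 0 ≤ q) (hp : p ∈ Set.Icc (0 : ℝ) 1) {φ : Vertex d → ℝ}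
    (hφ : ∀ x, 0 ≤ φ x) (x : Vertex d) :
    stepMean d q p (fun y => ENNReal.ofReal (φ y)) x
      = ENNReal.ofReal (q * p * φ x.tail + q * ((1 - p) / d) * ∑ i, φ (i :: x)) := by
  have h1p : 0 ≤ 1 - p := by linarith [hp.2]
  have h2 : 0 ≤ q * ((1 - p) / d) := by positivity
  have h3 : 0 ≤ q * p := mul_nonneg hq hp.1
  rw [stepMean, ENNReal.ofReal_add (mul_nonneg h3 (hφ _))
    (mul_nonneg h2 (Finset.sum_nonneg fun i _ => hφ _)), ENNReal.ofReal_mul h3,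
    ENNReal.ofReal_mul h2, ENNReal.ofReal_sum_of_nonneg fun i _ => hφ _, Finset.mul_sum]

/-- The weight `h ^ a * g ^ b`, where the geodesic from a vertex to `z` consists of `a` edges
towards the root followed by `b` edges away from it. -/
noncomputable def geodesicWeight (g h : ℝ) (z : Vertex d) : Vertex d → ℝ
  | [] => g ^ z.length
  | i :: t => if i :: t <:+ z then g ^ (z.length - (t.length + 1)) else h * geodesicWeight g h z t

theorem geodesicWeight_of_suffix {x z : Vertex d} (hx : x <:+ z) :
    geodesicWeight g h z x = g ^ (z.length - x.length) := by
  cases x with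
  | nil => rfl
  | cons i t => rw [geodesicWeight, if_pos hx, List.length_cons]

theorem geodesicWeight_cons {i : Fin d} {t z : Vertex d} (hx : ¬ i :: t <:+ z) :
    geodesicWeight g h z (i :: t) = h * geodesicWeight g h z t := by
  rw [geodesicWeight, if_neg hx]

theorem geodesicWeight_mem (hg : g ∈ Set.Icc (0 : ℝ) 1) (hh : h ∈ Set.Icc (0 : ℝ) 1)
    (z x : Vertex d) : geodesicWeight g h z x ∈ Set.Icc (0 : ℝ) 1 := by
  have hpow (n : ℕ) : g ^ n ∈ Set.Icc (0 : ℝ) 1 := ⟨pow_nonneg hg.1 n, pow_le_one₀ hg.1 hg.2⟩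
  induction x with
  | nil => exact hpow _
  | cons i t ih =>
    rw [geodesicWeight]
    split_ifs
    · exact hpow _
    · exact ⟨mul_nonneg hh.1 ih.1, mul_le_one₀ hh.2 ih.1 ih.2⟩

/-- Off the ancestral line of `z`, a step changes the number of edges towards the root by one, and
`hup` is the required inequality. On it, one child is an edge closer, the other `d - 1` children
cost a detour `h * g`, and the parent is an edge farther; this is `hdown`. -/
theorem geodesicWeight_subharmonic (hd : 1 ≤ d) (hq : 0 ≤ q) (hp : p ∈ Set.Icc (0 : ℝ) 1)
    (hg : g ∈ Set.Icc (0 : ℝ) 1) (hh : h ∈ Set.Icc (0 : ℝ) 1)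
    (hup : h ≤ q * p + q * (1 - p) * h ^ 2)
    (hdown : g ≤ q * p * g ^ 2 + q * ((1 - p) / d) * (1 + (d - 1) * (h * g)))
    {x z : Vertex d} (hxz : x ≠ z) :
    geodesicWeight g h z x ≤ q * p * geodesicWeight g h z x.tail
      + q * ((1 - p) / d) * ∑ i, geodesicWeight g h z (i :: x) := by
  classical
  have hd' : (1 : ℝ) ≤ d := by exact_mod_cast hd
  have h1p : 0 ≤ 1 - p := by linarith [hp.2]
  have h2 : 0 ≤ q * ((1 - p) / d) := by positivity
  have h3 : 0 ≤ q * p := mul_nonneg hq hp.1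
  by_cases hx : x <:+ z
  · obtain ⟨l, rfl⟩ := hx
    obtain ⟨l, c, rfl⟩ : ∃ l' c, l = l' ++ [c] :=
      ⟨_, _, (List.dropLast_append_getLast fun hl => hxz (by simp [hl])).symm⟩
    have hc : c :: x <:+ l ++ [c] ++ x := ⟨l, by simp⟩
    have hwx : geodesicWeight g h (l ++ [c] ++ x) x = g ^ (l.length + 1) := by
      rw [geodesicWeight_of_suffix ⟨_, rfl⟩]
      congr 1
      simp only [List.length_append, List.length_singleton]
      omega
    have hwc : geodesicWeight g h (l ++ [c] ++ x) (c :: x) = g ^ l.length := by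
      rw [geodesicWeight_of_suffix hc]
      congr 1
      simp only [List.length_append, List.length_cons, List.length_nil]
      omega
    -- Only an inequality, because at the root `x.tail = x` and the weight is `g ^ (l.length + 1)`.
    have hwt : g ^ (l.length + 2) ≤ geodesicWeight g h (l ++ [c] ++ x) x.tail := by
      rw [geodesicWeight_of_suffix ((List.tail_suffix x).trans ⟨_, rfl⟩)]
      refine pow_le_pow_of_le_one hg.1 hg.2 ?_
      simp only [List.length_append, List.length_singleton, List.length_tail]
      omega
    have hwi : ∀ i ∈ Finset.univ.erase c,
        geodesicWeight g h (l ++ [c] ++ x) (i :: x) = h * g ^ (l.length + 1) := by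
      intro i hi
      rw [geodesicWeight_cons, hwx]
      intro hs
      have := (List.suffix_of_suffix_length_le hs hc (by simp)).eq_of_length (by simp)
      exact (Finset.mem_erase.1 hi).1 (List.cons.inj this).1
    rw [← Finset.add_sum_erase _ _ (Finset.mem_univ c), Finset.sum_congr rfl hwi, hwc, hwx,
      Finset.sum_const, Finset.card_erase_of_mem (Finset.mem_univ c), Finset.card_univ,
      Fintype.card_fin, nsmul_eq_mul, Nat.cast_sub hd, Nat.cast_one]
    calc g ^ (l.length + 1) = g ^ l.length * g := pow_succ _ _
      _ ≤ g ^ l.length * (q * p * g ^ 2 + q * ((1 - p) / d) * (1 + (d - 1) * (h * g))) :=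
          mul_le_mul_of_nonneg_left hdown (pow_nonneg hg.1 _)
      _ = q * p * g ^ (l.length + 2)
          + q * ((1 - p) / d) * (g ^ l.length + (d - 1) * (h * g ^ (l.length + 1))) := by ring
      _ ≤ _ := by gcongr
  · obtain _ | ⟨j, t⟩ := x
    · exact absurd (List.nil_suffix) hx
    have hwi : ∀ i ∈ Finset.univ, geodesicWeight g h z (i :: j :: t)
        = h * (h * geodesicWeight g h z t) := by
      intro i _
      rw [geodesicWeight_cons fun hs => hx ((List.suffix_cons _ _).trans hs),
        geodesicWeight_cons hx]
    rw [Finset.sum_congr rfl hwi, geodesicWeight_cons hx, List.tail_cons, Finset.sum_const,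
      Finset.card_univ, Fintype.card_fin, nsmul_eq_mul]
    have hw := (geodesicWeight_mem hg hh z t).1
    calc h * geodesicWeight g h z t
        ≤ (q * p + q * (1 - p) * h ^ 2) * geodesicWeight g h z t := by gcongr
      _ = _ := by field_simp

variable [IsProbabilityMeasure (stepLaw d q p)]

theorem geodesicWeight_le_measure_hits (hd : 1 ≤ d) (hq : q ∈ Set.Ico (0 : ℝ) 1)
    (hp : p ∈ Set.Icc (0 : ℝ) 1) (hg : g ∈ Set.Icc (0 : ℝ) 1) (hh : h ∈ Set.Icc (0 : ℝ) 1)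
    (hup : h ≤ q * p + q * (1 - p) * h ^ 2)
    (hdown : g ≤ q * p * g ^ 2 + q * ((1 - p) / d) * (1 + (d - 1) * (h * g)))
    (x z : Vertex d) : geodesicWeight g h z x ≤ (law d q p).real (Hits x z) := by
  have hmem := geodesicWeight_mem hg hh z
  rw [measureReal_def, ← ENNReal.ofReal_le_iff_le_toReal (measure_ne_top _ _)]
  refine le_measure_hits hd hq hp (fun y => ENNReal.ofReal (geodesicWeight g h z y)) z
    (fun y => ENNReal.ofReal_le_one.2 (hmem y).2) (fun y hy => ?_) x
  rw [stepMean_ofReal hq.1 hp fun y => (hmem y).1]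
  exact ENNReal.ofReal_le_ofReal
    (geodesicWeight_subharmonic hd hq.1 hp hg hh hup hdown hy)

theorem geodesicWeight_nil (x : Vertex d) : geodesicWeight g h [] x = h ^ x.length := by
  induction x with
  | nil => simp [geodesicWeight]
  | cons i t ih =>
    rw [geodesicWeight_cons (by simp), ih, List.length_cons, pow_succ']

end HittingLowerBounds

/-! ### A weighted second moment inequality. -/

section SecondMoment

/-- The second moment method: a lower bound for the probability of a finite union of events, each
of which is weighted by the inverse of its probability. -/
theorem inv_le_measureReal_biUnion {Ω ι : Type*} [MeasurableSpace Ω] {μ : Measure Ω}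
    [IsProbabilityMeasure μ] {s : Finset ι} (hs : s.Nonempty) {E : ι → Set Ω}
    (hE : ∀ i, MeasurableSet (E i)) (hpos : ∀ i ∈ s, 0 < μ.real (E i)) {K : ℝ} (hK : 0 < K)
    (h : ∑ i ∈ s, ∑ j ∈ s, μ.real (E i ∩ E j) / (μ.real (E i) * μ.real (E j))
      ≤ K * (s.card : ℝ) ^ 2) :
    K⁻¹ ≤ μ.real (⋃ i ∈ s, E i) := by
  classical
  set U := ⋃ i ∈ s, E i with hU
  have hUm : MeasurableSet U := s.measurableSet_biUnion fun i _ => hE i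
  set c : ℝ := (s.card : ℝ) with hc
  have hcpos : 0 < c := by simpa [hc] using hs.card_pos
  -- In place of Cauchy–Schwarz, integrate `(N - t * 1_U) ^ 2 ≥ 0`, where `N` vanishes off `U`, has
  -- mean `c` and second moment at most `K * c ^ 2`. The choice `t = K * c` gives `1 ≤ K * μ.real
  -- U`.
  set t : ℝ := K * c
  let N : Ω → ℝ := fun ω => ∑ i ∈ s, (μ.real (E i))⁻¹ * (E i).indicator 1 ω
  have hint (A : Set Ω) (hA : MeasurableSet A) : Integrable (A.indicator (1 : Ω → ℝ)) μ :=
    (integrable_const (1 : ℝ)).indicator hA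
  have hNint : Integrable N μ := integrable_finsetSum _ fun i _ => (hint _ (hE i)).const_mul _
  have hNsq : (fun ω => N ω ^ 2) = fun ω => ∑ i ∈ s, ∑ j ∈ s,
      ((μ.real (E i))⁻¹ * (μ.real (E j))⁻¹) * (E i ∩ E j).indicator 1 ω := by
    funext ω
    simp only [N, sq, Finset.sum_mul_sum]
    refine Finset.sum_congr rfl fun i _ => Finset.sum_congr rfl fun j _ => ?_
    rw [Set.inter_indicator_one, Pi.mul_apply]
    ring
  have hNsqi (i j) : Integrable (fun ω => ((μ.real (E i))⁻¹ * (μ.real (E j))⁻¹) *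
      (E i ∩ E j).indicator (1 : Ω → ℝ) ω) μ := (hint _ ((hE i).inter (hE j))).const_mul _
  have hNsqint : Integrable (fun ω => N ω ^ 2) μ := by
    rw [hNsq]
    exact integrable_finsetSum _ fun i _ => integrable_finsetSum _ fun j _ => hNsqi i j
  have hEN : ∫ ω, N ω ∂μ = c := by
    simp only [N]
    rw [integral_finsetSum _ fun i _ => (hint _ (hE i)).const_mul _]
    have : ∀ i ∈ s, ∫ ω, (μ.real (E i))⁻¹ * (E i).indicator 1 ω ∂μ = 1 := by
      intro i hi
      rw [integral_const_mul, integral_indicator_one (hE i), inv_mul_cancel₀ (hpos i hi).ne']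
    rw [Finset.sum_congr rfl this]
    simp [hc]
  have hEN2 : ∫ ω, N ω ^ 2 ∂μ ≤ K * c ^ 2 := by
    refine le_trans (le_of_eq ?_) h
    rw [hNsq, integral_finsetSum _ fun i _ => integrable_finsetSum _ fun j _ => hNsqi i j]
    refine Finset.sum_congr rfl fun i _ => ?_
    rw [integral_finsetSum _ fun j _ => hNsqi i j]
    refine Finset.sum_congr rfl fun j _ => ?_
    rw [integral_const_mul, integral_indicator_one ((hE i).inter (hE j))]
    field_simp
  have hpt : ∀ ω, 0 ≤ N ω ^ 2 - 2 * t * N ω + t ^ 2 * U.indicator 1 ω := by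
    intro ω
    by_cases hω : ω ∈ U
    · rw [Set.indicator_of_mem hω, Pi.one_apply]
      nlinarith [sq_nonneg (N ω - t)]
    · have : N ω = 0 := Finset.sum_eq_zero fun i hi => by
        rw [Set.indicator_of_notMem, mul_zero]
        exact fun hi' => hω (Set.mem_biUnion hi hi')
      simp [this, hω]
  have hfin := integral_nonneg (μ := μ) (Pi.le_def.2 hpt)
  have hsub : Integrable (fun ω => N ω ^ 2 - 2 * t * N ω) μ :=
    hNsqint.sub (hNint.const_mul _)
  rw [integral_add hsub ((hint U hUm).const_mul _), integral_sub hNsqint (hNint.const_mul _),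
    integral_const_mul, integral_const_mul,
    integral_indicator_one hUm, hEN] at hfin
  have h1 : K * c ^ 2 ≤ K * c ^ 2 * (K * μ.real U) := by
    have : t = K * c := rfl
    rw [this] at hfin
    nlinarith
  have h2 : 1 ≤ K * μ.real U := by
    by_contra hlt
    have : 0 < K * c ^ 2 := by positivity
    nlinarith
  rwa [inv_le_iff_one_le_mul₀' hK]

end SecondMoment

/-! ### Two-level relays and their independence. -/

section Relays

variable {d : ℕ} {q p g h : ℝ}

/-- The vertex `j :: i :: v` is visited by the frog initially at `v`, or by the frog initially
at `i :: v` after the former has visited `i :: v`. -/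
def Relay (v : Vertex d) (i j : Fin d) : Set (Instructions d) :=
  Hits v (j :: i :: v) ∪ (Hits v (i :: v) ∩ Hits (i :: v) (j :: i :: v))

/-- The vertex, at even distance from the root, is reached from the root by a sequence of
relays. -/
def Reach : Vertex d → Set (Instructions d)
  | [] => Set.univ
  | [_] => ∅
  | j :: i :: v => Reach v ∩ Relay v i j

/-- The instructions of the frogs initially at the proper ancestors of `w`. -/
def ancestorRows (w : Vertex d) : Set (Vertex d × ℕ) := rows {u | u <:+ w ∧ u ≠ w}

theorem ancestorRows_subset_cons (i : Fin d) (v : Vertex d) :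
    ancestorRows v ⊆ ancestorRows (i :: v) :=
  rows_mono fun u ⟨hu, _⟩ => ⟨hu.trans (List.suffix_cons i v), fun e => by
    have := hu.length_le
    simp [e] at this⟩

theorem rows_subset_ancestorRows_cons (i : Fin d) (v : Vertex d) :
    rows {v} ⊆ ancestorRows (i :: v) :=
  rows_mono fun u hu => by
    rw [Set.mem_singleton_iff.1 hu]
    exact ⟨List.suffix_cons i v, (List.cons_ne_self i v).symm⟩

theorem measurableSet_relay (v : Vertex d) (i j : Fin d) :
    MeasurableSet[instrSigma (rows {v, i :: v})] (Relay v i j) := by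
  let _ := instrSigma (rows {v, i :: v})
  have h1 : rows {v} ⊆ rows ({v, i :: v} : Set (Vertex d)) := rows_mono (by simp)
  have h2 : rows {i :: v} ⊆ rows ({v, i :: v} : Set (Vertex d)) := rows_mono (by simp)
  exact (instrSigma_mono h1 _ (measurableSet_hits _ _)).union
    ((instrSigma_mono h1 _ (measurableSet_hits _ _)).inter
      (instrSigma_mono h2 _ (measurableSet_hits _ _)))

theorem rows_pair_subset (v : Vertex d) (i j : Fin d) :
    rows {v, i :: v} ⊆ ancestorRows (j :: i :: v) := by
  rintro ⟨u, k⟩ (hu | hu)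
  · exact ancestorRows_subset_cons j _ (rows_subset_ancestorRows_cons i v hu)
  · exact rows_subset_ancestorRows_cons j _ hu

theorem measurableSet_reach (w : Vertex d) : MeasurableSet[instrSigma (ancestorRows w)] (Reach w) :=
  match w with
  | [] => @MeasurableSet.univ _ (instrSigma _)
  | [_] => @MeasurableSet.empty _ (instrSigma _)
  | j :: i :: v => by
    let _ := instrSigma (ancestorRows (j :: i :: v))
    refine .inter ?_ ?_
    · exact instrSigma_mono ((ancestorRows_subset_cons i v).trans
        (ancestorRows_subset_cons j _)) _ (measurableSet_reach v)
    · exact instrSigma_mono (rows_pair_subset v i j) _ (measurableSet_relay v i j)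

variable [IsProbabilityMeasure (stepLaw d q p)]

theorem measureReal_inter_of_disjoint {S T : Set (Vertex d × ℕ)} (h : Disjoint S T)
    {A B : Set (Instructions d)} (hA : MeasurableSet[instrSigma S] A)
    (hB : MeasurableSet[instrSigma T] B) :
    (law d q p).real (A ∩ B) = (law d q p).real A * (law d q p).real B := by
  simp only [measureReal_def, measure_inter_of_disjoint h hA hB, ENNReal.toReal_mul]

theorem disjoint_rows_hits (v : Vertex d) (i : Fin d) : Disjoint (rows {v}) (rows {i :: v}) :=
  disjoint_rows (by simp)

/-- By inclusion–exclusion the probability is at least `x + y * z - x * z`, because the direct visit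
and the visit by the child's frog are independent. This is nondecreasing in `x` and `z`, and in `y`,
on the relevant range, so each may be replaced by its lower bound. -/
theorem le_measure_relay (hg : g ∈ Set.Icc (0 : ℝ) 1)
    (hchild : ∀ (v : Vertex d) i, g ≤ (law d q p).real (Hits v (i :: v)))
    (hgrand : ∀ (v : Vertex d) i j, g ^ 2 ≤ (law d q p).real (Hits v (j :: i :: v)))
    (v : Vertex d) (i j : Fin d) : 2 * g ^ 2 - g ^ 3 ≤ (law d q p).real (Relay v i j) := by
  set x := (law d q p).real (Hits v (j :: i :: v))
  set y := (law d q p).real (Hits v (i :: v))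
  set z := (law d q p).real (Hits (i :: v) (j :: i :: v))
  have hm (u w : Vertex d) : MeasurableSet (Hits u w) := measurableSet_pi (measurableSet_hits u w)
  have hunion : (law d q p).real (Relay v i j)
      + (law d q p).real (Hits v (j :: i :: v) ∩
        (Hits v (i :: v) ∩ Hits (i :: v) (j :: i :: v))) = x + y * z := by
    rw [← measureReal_inter_of_disjoint (disjoint_rows_hits v i) (measurableSet_hits _ _)
      (measurableSet_hits _ _)]
    exact measureReal_union_add_inter ((hm _ _).inter (hm _ _))
  have hinter : (law d q p).real (Hits v (j :: i :: v) ∩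
        (Hits v (i :: v) ∩ Hits (i :: v) (j :: i :: v))) ≤ x * z := by
    rw [← measureReal_inter_of_disjoint (disjoint_rows_hits v i) (measurableSet_hits _ _)
      (measurableSet_hits _ _)]
    exact measureReal_mono fun ω hω => ⟨hω.1, hω.2.2⟩
  have hz1 : z ≤ 1 := measureReal_le_one
  have hx : g ^ 2 ≤ x := hgrand v i j
  have hy : g ≤ y := hchild v i
  have hz : g ≤ z := hchild (i :: v) j
  have h1 : g ^ 2 * (1 - z) ≤ x * (1 - z) := by gcongr
  have h2 : g * z ≤ y * z := by gcongr
  have h3 : (g - g ^ 2) * g ≤ (g - g ^ 2) * z := by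
    gcongr
    nlinarith [hg.1, hg.2]
  nlinarith

theorem measure_reach_cons (v : Vertex d) (i j : Fin d) :
    (law d q p).real (Reach (j :: i :: v))
      = (law d q p).real (Reach v) * (law d q p).real (Relay v i j) := by
  refine measureReal_inter_of_disjoint (disjoint_rows ?_) (measurableSet_reach v)
    (measurableSet_relay v i j)
  refine Set.disjoint_left.2 ?_
  rintro u ⟨hu, hne⟩ (rfl | rfl)
  · exact hne rfl
  · have := hu.length_le
    simp at this

/-- The final relays involve only the frogs at `v`, `i :: v`, `w` and `k :: w`. These are distinct,
and none is a proper ancestor of `v` or `w`. -/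
theorem reach_inter_reach {v w : Vertex d} (hlen : v.length = w.length) (hvw : v ≠ w)
    (i j k l : Fin d) :
    (law d q p).real (Reach (j :: i :: v) ∩ Reach (l :: k :: w))
      = (law d q p).real (Reach v ∩ Reach w) *
        ((law d q p).real (Relay v i j) * (law d q p).real (Relay w k l)) := by
  have hset : Reach (j :: i :: v) ∩ Reach (l :: k :: w)
      = (Reach v ∩ Reach w) ∩ (Relay v i j ∩ Relay w k l) := by
    simp only [Reach]
    exact Set.inter_inter_inter_comm _ _ _ _
  have hrr : Disjoint ({v, i :: v} : Set (Vertex d)) {w, k :: w} := by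
    have h1 : v ≠ k :: w := fun e => by simp [e] at hlen
    have h2 : w ≠ i :: v := fun e => by simp [e] at hlen
    simp [h2, Ne.symm h1, hvw.symm]
  have ha : ∀ u, (u <:+ v ∧ u ≠ v) ∨ (u <:+ w ∧ u ≠ w) → u.length < v.length := by
    rintro u (⟨hu, hne⟩ | ⟨hu, hne⟩)
    · exact lt_of_le_of_ne hu.length_le fun e => hne (hu.eq_of_length e)
    · rw [hlen]
      exact lt_of_le_of_ne hu.length_le fun e => hne (hu.eq_of_length e)
  have har : Disjoint ({u | u <:+ v ∧ u ≠ v} ∪ {u | u <:+ w ∧ u ≠ w})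
      (({v, i :: v} : Set (Vertex d)) ∪ {w, k :: w}) := by
    refine Set.disjoint_left.2 fun u hu hu' => ?_
    have h1 := ha u hu
    rcases hu' with (rfl | rfl) | (rfl | rfl) <;>
      (try rw [List.length_cons] at h1) <;> omega
  rw [hset, measureReal_inter_of_disjoint (disjoint_rows har),
    measureReal_inter_of_disjoint (disjoint_rows hrr) (measurableSet_relay v i j)
      (measurableSet_relay w k l)]
  · let _ := instrSigma (rows ({u | u <:+ v ∧ u ≠ v} ∪ {u | u <:+ w ∧ u ≠ w}))
    exact .inter (instrSigma_mono (rows_mono Set.subset_union_left) _ (measurableSet_reach v))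
      (instrSigma_mono (rows_mono Set.subset_union_right) _ (measurableSet_reach w))
  · let _ := instrSigma (rows (({v, i :: v} : Set (Vertex d)) ∪ {w, k :: w}))
    exact .inter (instrSigma_mono (rows_mono Set.subset_union_left) _ (measurableSet_relay v i j))
      (instrSigma_mono (rows_mono Set.subset_union_right) _ (measurableSet_relay w k l))

theorem measure_reach_hits {v w : Vertex d} (hlen : v.length = w.length) (hvw : v ≠ w) :
    (law d q p).real ((Reach v ∩ Hits v []) ∩ (Reach w ∩ Hits w []))
      = (law d q p).real (Reach v ∩ Reach w) *
        ((law d q p).real (Hits v []) * (law d q p).real (Hits w [])) := by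
  have hu (u : Vertex d) (hu : (u <:+ v ∧ u ≠ v) ∨ (u <:+ w ∧ u ≠ w)) : u ≠ v ∧ u ≠ w := by
    rcases hu with ⟨hu, hne⟩ | ⟨hu, hne⟩
    · exact ⟨hne, fun e => hne (hu.eq_of_length (by rw [e, hlen]))⟩
    · exact ⟨fun e => hne (hu.eq_of_length (by rw [e, hlen])), hne⟩
  have har : Disjoint ({u | u <:+ v ∧ u ≠ v} ∪ {u | u <:+ w ∧ u ≠ w})
      (({v} : Set (Vertex d)) ∪ {w}) := by
    refine Set.disjoint_left.2 fun u h1 h2 => ?_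
    rcases h2 with h2 | h2
    exacts [(hu u h1).1 h2, (hu u h1).2 h2]
  rw [Set.inter_inter_inter_comm, measureReal_inter_of_disjoint (disjoint_rows har),
    measureReal_inter_of_disjoint (disjoint_rows (by simpa using hvw)) (measurableSet_hits _ _)
      (measurableSet_hits _ _)]
  · let _ := instrSigma (rows ({u | u <:+ v ∧ u ≠ v} ∪ {u | u <:+ w ∧ u ≠ w}))
    exact .inter (instrSigma_mono (rows_mono Set.subset_union_left) _ (measurableSet_reach v))
      (instrSigma_mono (rows_mono Set.subset_union_right) _ (measurableSet_reach w))
  · let _ := instrSigma (rows (({v} : Set (Vertex d)) ∪ {w}))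
    exact .inter (instrSigma_mono (rows_mono Set.subset_union_left) _ (measurableSet_hits v _))
      (instrSigma_mono (rows_mono Set.subset_union_right) _ (measurableSet_hits w _))

theorem measure_reach_inter_hits (v : Vertex d) :
    (law d q p).real (Reach v ∩ Hits v [])
      = (law d q p).real (Reach v) * (law d q p).real (Hits v []) := by
  refine measureReal_inter_of_disjoint (disjoint_rows ?_) (measurableSet_reach v)
    (measurableSet_hits v [])
  exact Set.disjoint_singleton_right.2 fun h => h.2 rfl

end Relays

/-! ### Second moment estimate on the even levels. -/

section Levels

variable {d : ℕ} {q p ρ h : ℝ}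

/-- The grandchildren of all vertices. -/
def grandchild (d : ℕ) : Vertex d × Fin d × Fin d ↪ Vertex d where
  toFun x := x.2.2 :: x.2.1 :: x.1
  inj' := by
    rintro ⟨v, i, j⟩ ⟨w, k, l⟩ h
    simp only [List.cons.injEq] at h
    rw [h.1, h.2.1, h.2.2]

/-- The vertices at distance `2 * n` from the root. -/
def evenLevel (d : ℕ) : ℕ → Finset (Vertex d)
  | 0 => {[]}
  | n + 1 => (evenLevel d n ×ˢ (Finset.univ ×ˢ Finset.univ)).map (grandchild d)

theorem exists_of_mem_evenLevel_succ {n : ℕ} {w : Vertex d} (hw : w ∈ evenLevel d (n + 1)) :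
    ∃ v ∈ evenLevel d n, ∃ i j, w = j :: i :: v := by
  obtain ⟨⟨v, i, j⟩, hv, rfl⟩ := Finset.mem_map.1 hw
  exact ⟨v, (Finset.mem_product.1 hv).1, i, j, rfl⟩

theorem sum_evenLevel_succ (f : Vertex d → ℝ) (n : ℕ) :
    ∑ w ∈ evenLevel d (n + 1), f w = ∑ v ∈ evenLevel d n, ∑ i, ∑ j, f (j :: i :: v) := by
  rw [evenLevel, Finset.sum_map, Finset.sum_product]
  refine Finset.sum_congr rfl fun v _ => ?_
  rw [Finset.sum_product]
  rfl

theorem card_evenLevel (n : ℕ) : ((evenLevel d n).card : ℝ) = (d : ℝ) ^ (2 * n) := by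
  induction n with
  | zero => simp [evenLevel]
  | succ n ih =>
    have := sum_evenLevel_succ (d := d) (fun _ => (1 : ℝ)) n
    simp only [Finset.sum_const, nsmul_eq_mul, mul_one, Finset.card_univ, Fintype.card_fin] at this
    rw [this, ih]
    ring

theorem length_of_mem_evenLevel {n : ℕ} {w : Vertex d} (hw : w ∈ evenLevel d n) :
    w.length = 2 * n := by
  induction n generalizing w with
  | zero => simpa [evenLevel] using hw
  | succ n ih =>
    obtain ⟨v, hv, i, j, rfl⟩ := exists_of_mem_evenLevel_succ hw
    simp [ih hv]
    ring

/-- The normalized probability that `v` and `w` are both reached. -/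
noncomputable def reachCorr (d : ℕ) (q p : ℝ) (v w : Vertex d) : ℝ :=
  (law d q p).real (Reach v ∩ Reach w) / ((law d q p).real (Reach v) * (law d q p).real (Reach w))

theorem reachCorr_nonneg (v w : Vertex d) : 0 ≤ reachCorr d q p v w := by
  unfold reachCorr
  positivity

variable [IsProbabilityMeasure (stepLaw d q p)]

theorem pow_le_measure_reach (hρ : 0 < ρ)
    (hrelay : ∀ (v : Vertex d) i j, ρ ≤ (law d q p).real (Relay v i j)) {n : ℕ} {w : Vertex d}
    (hw : w ∈ evenLevel d n) : ρ ^ n ≤ (law d q p).real (Reach w) := by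
  induction n generalizing w with
  | zero =>
    obtain rfl : w = [] := by simpa [evenLevel] using hw
    simp [Reach]
  | succ n ih =>
    obtain ⟨v, hv, i, j, rfl⟩ := exists_of_mem_evenLevel_succ hw
    rw [pow_succ]
    rw [measure_reach_cons]
    have := ih hv
    have := hrelay v i j
    gcongr

/-- For `v ≠ w` the new relay factors cancel exactly, so the correlation is inherited. This is the
benefit of normalizing: relay probabilities need not be equal. For `v = w` the correlation is at
most the inverse of one reaching probability. -/
theorem reachCorr_cons_le (hρ : 0 < ρ)
    (hrelay : ∀ (v : Vertex d) i j, ρ ≤ (law d q p).real (Relay v i j)) {n : ℕ} {v w : Vertex d}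
    (hv : v ∈ evenLevel d n) (hw : w ∈ evenLevel d n) (i j k l : Fin d) :
    reachCorr d q p (j :: i :: v) (l :: k :: w)
      ≤ reachCorr d q p v w + if v = w then (ρ ^ (n + 1))⁻¹ else 0 := by
  have hRv := (pow_pos hρ n).trans_le (pow_le_measure_reach hρ hrelay hv)
  have hRw := (pow_pos hρ n).trans_le (pow_le_measure_reach hρ hrelay hw)
  have hBv := hρ.trans_le (hrelay v i j)
  have hBw := hρ.trans_le (hrelay w k l)
  split_ifs with hvw
  · refine le_trans ?_ (le_add_of_nonneg_left (reachCorr_nonneg _ _))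
    have h1 : 0 < (law d q p).real (Reach (j :: i :: v)) := by
      rw [measure_reach_cons]; positivity
    have h2 : ρ ^ (n + 1) ≤ (law d q p).real (Reach (l :: k :: w)) := by
      rw [measure_reach_cons, pow_succ]
      have := pow_le_measure_reach hρ hrelay hw
      have := hrelay w k l
      gcongr
    have h3 : (law d q p).real (Reach (j :: i :: v) ∩ Reach (l :: k :: w))
        ≤ (law d q p).real (Reach (j :: i :: v)) := measureReal_mono Set.inter_subset_left
    unfold reachCorr
    calc _ ≤ (law d q p).real (Reach (j :: i :: v)) / ((law d q p).real (Reach (j :: i :: v)) *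
            ρ ^ (n + 1)) := by gcongr
      _ = _ := by field_simp
  · rw [add_zero]
    unfold reachCorr
    rw [reach_inter_reach (by rw [length_of_mem_evenLevel hv, length_of_mem_evenLevel hw]) hvw,
      measure_reach_cons, measure_reach_cons]
    refine le_of_eq ?_
    field_simp

/-- After division by `d ^ (4 * n)`, passing from level `n` to `n + 1` adds at most `d ^ 2 * (d ^ 2
* ρ)⁻¹ ^ (n + 1)`; the bound is the partial sum of this geometric series. -/
theorem sum_reachCorr_le (hρ : 0 < ρ) (hκ : 1 < d ^ 2 * ρ)
    (hrelay : ∀ (v : Vertex d) i j, ρ ≤ (law d q p).real (Relay v i j)) (n : ℕ) :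
    ∑ v ∈ evenLevel d n, ∑ w ∈ evenLevel d n, reachCorr d q p v w
      ≤ ((d : ℝ) ^ (2 * n)) ^ 2 *
        (1 + d ^ 2 / (d ^ 2 * ρ - 1) - d ^ 2 / (d ^ 2 * ρ - 1) * ((d ^ 2 * ρ) ^ n)⁻¹) := by
  have hκ' : 0 < d ^ 2 * ρ - 1 := by linarith
  have hd : (d : ℝ) ≠ 0 := by
    rintro h
    norm_num [h] at hκ
  induction n with
  | zero => simp [evenLevel, reachCorr, Reach]
  | succ n ih =>
    have step : ∑ v ∈ evenLevel d (n + 1), ∑ w ∈ evenLevel d (n + 1), reachCorr d q p v w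
        ≤ ∑ v ∈ evenLevel d n, ∑ i : Fin d, ∑ j : Fin d, ∑ w ∈ evenLevel d n, ∑ k : Fin d,
          ∑ l : Fin d, (reachCorr d q p v w + if v = w then (ρ ^ (n + 1))⁻¹ else 0) := by
      rw [sum_evenLevel_succ]
      refine Finset.sum_le_sum fun v hv => Finset.sum_le_sum fun i _ =>
        Finset.sum_le_sum fun j _ => ?_
      rw [sum_evenLevel_succ]
      exact Finset.sum_le_sum fun w hw => Finset.sum_le_sum fun k _ =>
        Finset.sum_le_sum fun l _ => reachCorr_cons_le hρ hrelay hv hw i j k l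
    have eval : ∑ v ∈ evenLevel d n, ∑ i : Fin d, ∑ j : Fin d, ∑ w ∈ evenLevel d n, ∑ k : Fin d,
          ∑ l : Fin d, (reachCorr d q p v w + if v = w then (ρ ^ (n + 1))⁻¹ else 0)
        = d ^ 4 * ((∑ v ∈ evenLevel d n, ∑ w ∈ evenLevel d n, reachCorr d q p v w)
          + d ^ (2 * n) * (ρ ^ (n + 1))⁻¹) := by
      have hdiag : ∑ v ∈ evenLevel d n, ∑ w ∈ evenLevel d n,
          (if v = w then (ρ ^ (n + 1))⁻¹ else 0) = d ^ (2 * n) * (ρ ^ (n + 1))⁻¹ := by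
        rw [← card_evenLevel, ← nsmul_eq_mul, ← Finset.sum_const]
        refine Finset.sum_congr rfl fun v hv => ?_
        rw [Finset.sum_ite_eq, if_pos hv]
      rw [← hdiag, ← Finset.sum_add_distrib]
      simp_rw [← Finset.sum_add_distrib]
      simp only [Finset.sum_const, Finset.card_univ, Fintype.card_fin, nsmul_eq_mul,
        ← Finset.mul_sum]
      ring
    refine (step.trans_eq eval).trans ?_
    have h4 : (0 : ℝ) ≤ d ^ 4 := by positivity
    refine (mul_le_mul_of_nonneg_left (add_le_add_left ih _) h4).trans (le_of_eq ?_)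
    field_simp
    ring

/-- Visits to the root use the frogs of the level itself, which are independent of `Reach`, so they
affect only the diagonal. By `hκh` the diagonal contributes at most one further unit, hence `2` in
place of `1`. -/
theorem inv_le_measure_iUnion_reach_hits (hρ : 0 < ρ) (hκ : 1 < d ^ 2 * ρ) (hh : 0 < h)
    (hκh : 1 ≤ d ^ 2 * ρ * h ^ 2)
    (hrelay : ∀ (v : Vertex d) i j, ρ ≤ (law d q p).real (Relay v i j))
    (hroot : ∀ v : Vertex d, h ^ v.length ≤ (law d q p).real (Hits v [])) (n : ℕ) :
    (2 + d ^ 2 / (d ^ 2 * ρ - 1))⁻¹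
      ≤ (law d q p).real (⋃ v ∈ evenLevel d n, Reach v ∩ Hits v []) := by
  have hκ' : 0 < d ^ 2 * ρ - 1 := by linarith
  have hd : 0 < (d : ℝ) := by
    refine lt_of_le_of_ne (Nat.cast_nonneg d) fun h => ?_
    norm_num [← h] at hκ
  have hR {v} (hv : v ∈ evenLevel d n) := pow_le_measure_reach hρ hrelay hv
  have hRpos {v} (hv : v ∈ evenLevel d n) := (pow_pos hρ n).trans_le (hR hv)
  have hHpos (v : Vertex d) := (pow_pos hh v.length).trans_le (hroot v)
  have hG {v} (hv : v ∈ evenLevel d n) : 0 < (law d q p).real (Reach v ∩ Hits v []) := by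
    rw [measure_reach_inter_hits]
    exact mul_pos (hRpos hv) (hHpos v)
  refine inv_le_measureReal_biUnion ?_ ?_ (fun v hv => hG hv) (by positivity) ?_
  · rw [← Finset.card_pos, ← Nat.cast_pos (α := ℝ), card_evenLevel]
    positivity
  · exact fun v => (measurableSet_pi (measurableSet_reach v)).inter
      (measurableSet_pi (measurableSet_hits v []))
  have hterm : ∀ v ∈ evenLevel d n, ∀ w ∈ evenLevel d n,
      (law d q p).real ((Reach v ∩ Hits v []) ∩ (Reach w ∩ Hits w [])) /
        ((law d q p).real (Reach v ∩ Hits v []) * (law d q p).real (Reach w ∩ Hits w []))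
      ≤ reachCorr d q p v w + if v = w then ((ρ * h ^ 2) ^ n)⁻¹ else 0 := by
    intro v hv w hw
    split_ifs with hvw
    · subst hvw
      refine le_trans ?_ (le_add_of_nonneg_left (reachCorr_nonneg _ _))
      have hb : (ρ * h ^ 2) ^ n ≤ (law d q p).real (Reach v ∩ Hits v []) := by
        rw [measure_reach_inter_hits, mul_pow, ← pow_mul, ← length_of_mem_evenLevel hv]
        have := hR hv
        have := hroot v
        gcongr
      rw [Set.inter_self, div_mul_cancel_left₀ (hG hv).ne']
      gcongr
    · rw [add_zero, measure_reach_hits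
        (by rw [length_of_mem_evenLevel hv, length_of_mem_evenLevel hw]) hvw,
        measure_reach_inter_hits, measure_reach_inter_hits]
      have := hHpos v
      have := hHpos w
      unfold reachCorr
      refine le_of_eq ?_
      field_simp
  refine (Finset.sum_le_sum fun v hv => Finset.sum_le_sum fun w hw => hterm v hv w hw).trans ?_
  simp_rw [Finset.sum_add_distrib]
  have hdiag : ∑ v ∈ evenLevel d n, ∑ w ∈ evenLevel d n,
      (if v = w then ((ρ * h ^ 2) ^ n)⁻¹ else 0) = d ^ (2 * n) * ((ρ * h ^ 2) ^ n)⁻¹ := by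
    rw [← card_evenLevel, ← nsmul_eq_mul, ← Finset.sum_const]
    refine Finset.sum_congr rfl fun v hv => ?_
    rw [Finset.sum_ite_eq, if_pos hv]
  have hdiag_le : (d : ℝ) ^ (2 * n) * ((ρ * h ^ 2) ^ n)⁻¹ ≤ ((d : ℝ) ^ (2 * n)) ^ 2 := by
    rw [sq ((d : ℝ) ^ (2 * n))]
    refine mul_le_mul_of_nonneg_left ?_ (by positivity)
    have hpos : 0 < (ρ * h ^ 2) ^ n := by positivity
    rw [inv_le_iff_one_le_mul₀ hpos, pow_mul, ← mul_pow, ← mul_assoc]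
    exact one_le_pow₀ hκh
  have hcorr := sum_reachCorr_le hρ hκ hrelay n
  have hle : ((d : ℝ) ^ (2 * n)) ^ 2 *
        (1 + d ^ 2 / (d ^ 2 * ρ - 1) - d ^ 2 / (d ^ 2 * ρ - 1) * ((d ^ 2 * ρ) ^ n)⁻¹)
      ≤ ((d : ℝ) ^ (2 * n)) ^ 2 * (1 + d ^ 2 / (d ^ 2 * ρ - 1)) := by
    refine mul_le_mul_of_nonneg_left (sub_le_self _ ?_) (by positivity)
    positivity
  rw [hdiag, card_evenLevel]
  linarith

end Levels

/-! ### From reaching deep levels to recurrence, and the numerical constants. -/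

section Recurrence

variable {d : ℕ} {q p g h : ℝ} {ω : Instructions d}

theorem age_add {t k : ℕ} {v : Vertex d} (hv : age ω t v = some k) (n : ℕ) :
    age ω (t + n) v = some (k + n) := by
  induction n with
  | zero => exact hv
  | succ n ih => exact age_succ_of_eq_some ih

theorem exists_age_eq_zero {t : ℕ} {v : Vertex d} (hv : age ω t v ≠ none) :
    ∃ s, age ω s v = some 0 := by
  induction t with
  | zero =>
    by_cases h : v = []
    · exact ⟨0, by simp [age, h]⟩
    · simp [age, h] at hv
  | succ t ih =>
    by_cases h : age ω t v = none
    · exact ⟨t + 1, (exists_activator h hv).1⟩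
    · exact ih h

theorem exists_activeAt_of_hits {t : ℕ} {v z : Vertex d} (hv : age ω t v ≠ none)
    (hz : ω ∈ Hits v z) : ∃ t, ActiveAt ω t v z := by
  obtain ⟨s, hs⟩ := exists_age_eq_zero hv
  obtain ⟨j, hj⟩ := hz
  exact ⟨s + j, j, by simpa using age_add hs j, hj⟩

theorem exists_age_ne_none_of_hits {v z : Vertex d} (hv : ∃ t, age ω t v ≠ none)
    (hz : ω ∈ Hits v z) : ∃ t, age ω t z ≠ none := by
  obtain ⟨t, hv⟩ := hv
  obtain ⟨s, k, hk, hw⟩ := exists_activeAt_of_hits hv hz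
  exact ⟨s, age_ne_none_of_walk hk le_rfl hw⟩

theorem exists_age_ne_none_of_reach (w : Vertex d) (hw : ω ∈ Reach w) :
    ∃ t, age ω t w ≠ none :=
  match w with
  | [] => ⟨0, by simp [age]⟩
  | [_] => hw.elim
  | j :: i :: v => by
    have hv := exists_age_ne_none_of_reach v hw.1
    rcases hw.2 with h | ⟨h1, h2⟩
    · exact exists_age_ne_none_of_hits hv h
    · exact exists_age_ne_none_of_hits (exists_age_ne_none_of_hits hv h1) h2

theorem recurrent_of_frequently_reach
    (hω : ∀ n, ∃ m ≥ n, ω ∈ ⋃ v ∈ evenLevel d m, Reach v ∩ Hits v []) : Recurrent ω := by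
  refine Set.Infinite.mono (s := {v | ω ∈ Reach v ∩ Hits v []}) ?_ ?_
  · rintro v ⟨hr, hh⟩
    obtain ⟨t, ht⟩ := exists_age_ne_none_of_reach v hr
    exact exists_activeAt_of_hits ht hh
  · refine Set.Infinite.of_image List.length (Set.infinite_of_not_bddAbove ?_)
    rintro ⟨b, hb⟩
    obtain ⟨m, hm, hmem⟩ := hω (b + 1)
    simp only [Set.mem_iUnion] at hmem
    obtain ⟨v, hv, hmem⟩ := hmem
    have := hb ⟨v, hmem, rfl⟩
    rw [length_of_mem_evenLevel hv] at this
    omega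

theorem measurableSet_biUnion_reach_hits (n : ℕ) :
    MeasurableSet (⋃ v ∈ evenLevel d n, Reach v ∩ Hits v []) :=
  Finset.measurableSet_biUnion _ fun v _ => (measurableSet_pi (measurableSet_reach v)).inter
    (measurableSet_pi (measurableSet_hits v []))

/-- Events whose probabilities are bounded below occur infinitely often with positive
probability. -/
theorem le_measureReal_limsup {Ω : Type*} [MeasurableSpace Ω] {μ : Measure Ω}
    [IsProbabilityMeasure μ] {E : ℕ → Set Ω} (hE : ∀ n, MeasurableSet (E n)) {c : ℝ}
    (h : ∀ n, c ≤ μ.real (E n)) : c ≤ μ.real {ω | ∀ n, ∃ m ≥ n, ω ∈ E m} := by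
  have hset : {ω | ∀ n, ∃ m ≥ n, ω ∈ E m} = ⋂ n, ⋃ m ≥ n, E m := by
    ext ω
    simp
  have hanti : Antitone fun n => ⋃ m ≥ n, E m := fun a b hab =>
    Set.biUnion_mono (fun m hm => le_trans hab hm) fun _ _ => le_rfl
  have hlim := tendsto_measure_iInter_atTop (μ := μ)
    (fun n => (MeasurableSet.iUnion fun m => MeasurableSet.iUnion fun _ : m ≥ n =>
      hE m).nullMeasurableSet) hanti ⟨0, measure_ne_top _ _⟩
  rw [hset]
  refine ge_of_tendsto' ((ENNReal.tendsto_toReal (measure_ne_top _ _)).comp hlim) fun n => ?_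
  exact (h n).trans (measureReal_mono (fun ω hω => Set.mem_iUnion₂.2 ⟨n, le_rfl, hω⟩)
    (measure_ne_top _ _))

theorem recurrenceProb_pos_of_hits (hd : 1 ≤ d) (hq : q ∈ Set.Ico (0 : ℝ) 1)
    (hp : p ∈ Set.Icc (0 : ℝ) 1) (hg : g ∈ Set.Ioc (0 : ℝ) 1) (hh : h ∈ Set.Ioc (0 : ℝ) 1)
    (hup : h ≤ q * p + q * (1 - p) * h ^ 2)
    (hdown : g ≤ q * p * g ^ 2 + q * ((1 - p) / d) * (1 + (d - 1) * (h * g)))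
    (hκ : 1 < d ^ 2 * (2 * g ^ 2 - g ^ 3) * h ^ 2) : 0 < recurrenceProb d q p := by
  have := isProbabilityMeasure_stepLaw (d := d) hd ⟨hq.1, hq.2.le⟩ hp
  have hg' : g ∈ Set.Icc (0 : ℝ) 1 := ⟨hg.1.le, hg.2⟩
  have hweight := geodesicWeight_le_measure_hits hd hq hp hg' ⟨hh.1.le, hh.2⟩ hup hdown
  have hchild (v : Vertex d) (i) : g ≤ (law d q p).real (Hits v (i :: v)) := by
    simpa [geodesicWeight_of_suffix (List.suffix_cons i v)] using hweight v (i :: v)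
  have hgrand (v : Vertex d) (i j) : g ^ 2 ≤ (law d q p).real (Hits v (j :: i :: v)) := by
    have hs : v <:+ j :: i :: v := (List.suffix_cons i v).trans (List.suffix_cons j _)
    have := hweight v (j :: i :: v)
    have hlen : (j :: i :: v).length - v.length = 2 := by
      simp only [List.length_cons]
      omega
    rwa [geodesicWeight_of_suffix hs, hlen] at this
  have hroot (v : Vertex d) : h ^ v.length ≤ (law d q p).real (Hits v []) := by
    rw [← geodesicWeight_nil (g := g)]
    exact hweight v []
  have hρ : 0 < 2 * g ^ 2 - g ^ 3 := by
    have : 0 < g ^ 2 * (2 - g) := mul_pos (pow_pos hg.1 2) (by linarith [hg.2])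
    linarith
  have hκ1 : 1 < d ^ 2 * (2 * g ^ 2 - g ^ 3) :=
    hκ.trans_le (mul_le_of_le_one_right (by positivity) (pow_le_one₀ hh.1.le hh.2))
  have hpos : 0 < (2 + (d : ℝ) ^ 2 / (d ^ 2 * (2 * g ^ 2 - g ^ 3) - 1))⁻¹ := by
    have : 0 < d ^ 2 * (2 * g ^ 2 - g ^ 3) - 1 := by linarith
    positivity
  refine hpos.trans_le ((le_measureReal_limsup measurableSet_biUnion_reach_hits
    (inv_le_measure_iUnion_reach_hits hρ hκ1 hh.1 hκ.le (le_measure_relay hg' hchild hgrand)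
      hroot)).trans ?_)
  -- Monotonicity holds for outer measure, so measurability of the recurrence event is not needed.
  exact measureReal_mono fun ω hω => recurrent_of_frequently_reach hω

theorem recurrenceProb_pos (hd : 2 ≤ d) (hq : q ∈ Set.Ico (0.9999998 : ℝ) 1)
    (hp : p ∈ Set.Icc (0.4950 : ℝ) 0.4975) : 0 < recurrenceProb d q p := by
  obtain ⟨hq0, hq1⟩ := hq
  obtain ⟨hp0, hp1⟩ := hp
  have hd' : (2 : ℝ) ≤ d := by exact_mod_cast hd
  have hd0 : (0 : ℝ) < d := by linarith
  have hg1 : 0.95 / (d : ℝ) ≤ 1 := by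
    rw [div_le_one hd0]
    linarith
  refine recurrenceProb_pos_of_hits (g := 0.95 / d) (h := 0.95) (by omega) ⟨by linarith, hq1⟩
    ⟨by linarith, by linarith⟩ ⟨by positivity, hg1⟩ ⟨by norm_num, by norm_num⟩ ?_ ?_ ?_
  -- This inequality for `h` uses the lower bound on `p`; the one for `g` below uses the upper
  -- bound, with `d = 2` the worst case.
  · nlinarith
  · have key : 0.95 ≤ q * ((1 - p) * 1.9025 - 0.9025 * (1 - 2 * p) * (1 / d)) := by
      have h1 : 1 / (d : ℝ) ≤ 1 / 2 := one_div_le_one_div_of_le two_pos hd'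
      have h2 : 0.9025 * (1 - 2 * p) * (1 / d) ≤ 0.9025 * (1 - 2 * p) * (1 / 2) := by
        gcongr
        linarith
      have h3 : 0.953 ≤ (1 - p) * 1.9025 - 0.9025 * (1 - 2 * p) * (1 / d) := by linarith
      calc (0.95 : ℝ) ≤ 0.9999998 * 0.953 := by norm_num
        _ ≤ _ := by gcongr
    calc 0.95 / (d : ℝ) ≤ q * ((1 - p) * 1.9025 - 0.9025 * (1 - 2 * p) * (1 / d)) / d := by gcongr
      _ = _ := by field_simp; ring
  -- The powers of `d` cancel except for one factor `1 / d`, so `d = 2` is again the worst case.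
  · have h1 : (d : ℝ) ^ 2 * (2 * (0.95 / d) ^ 2 - (0.95 / d) ^ 3) * 0.95 ^ 2
        = 0.95 ^ 4 * (2 - 0.95 * (1 / d)) := by
      field_simp
    have h2 : 1 / (d : ℝ) ≤ 1 / 2 := one_div_le_one_div_of_le two_pos hd'
    rw [h1]
    calc (1 : ℝ) < 0.95 ^ 4 * (2 - 0.95 * (1 / 2)) := by norm_num
      _ ≤ _ := by gcongr

end Recurrence

end FrogModel

/-! ### The phase picture and the failure of monotonicity. -/

theorem corollary1p3 (d : ℕ) (hd : 2 ≤ d) (q : ℝ) (hq : q ∈ Set.Ico (0.9999998 : ℝ) 1) :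
    (∀ p ∈ Set.Icc (0 : ℝ) 1, p < 1 / (1 + q * d) → FrogModel.recurrenceProb d q p = 0) ∧
    (∀ p ∈ Set.Icc (0 : ℝ) 1, 2 - q⁻¹ ≤ p → FrogModel.recurrenceProb d q p = 0) ∧
    (∀ p ∈ Set.Icc (0.4950 : ℝ) 0.4975, 0 < FrogModel.recurrenceProb d q p) ∧
    ¬ MonotoneOn (fun p : ℝ => FrogModel.recurrenceProb d q p) (Set.Ioo 0 1) ∧
    ¬ AntitoneOn (fun p : ℝ => FrogModel.recurrenceProb d q p) (Set.Ioo 0 1) := by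
  have hq0 : 0 < q := by linarith [hq.1]
  have hq01 : q ∈ Set.Ioo (0 : ℝ) 1 := ⟨hq0, hq.2⟩
  have hinv : 1 < q⁻¹ := (one_lt_inv₀ hq0).2 hq.2
  have hinv' : q⁻¹ ≤ 1.1 := by
    rw [inv_le_comm₀ hq0 (by norm_num)]
    linarith [hq.1, show (1.1 : ℝ)⁻¹ ≤ 0.9999998 by norm_num]
  have hweak := fun p (hp : p ∈ Set.Icc (0 : ℝ) 1) =>
    FrogModel.recurrenceProb_eq_zero_of_lt hd hq01 hp
  have hstrong : ∀ p ∈ Set.Icc (0 : ℝ) 1, 2 - q⁻¹ ≤ p → FrogModel.recurrenceProb d q p = 0 :=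
    fun p hp hqp =>
      FrogModel.recurrenceProb_eq_zero_of_le (by omega) hq01 hp (by linarith) hqp
  have hmid := fun p (hp : p ∈ Set.Icc (0.4950 : ℝ) 0.4975) =>
    FrogModel.recurrenceProb_pos hd hq hp
  refine ⟨hweak, hstrong, hmid, fun hmono => ?_, fun hanti => ?_⟩
  -- The probability is positive at `0.496` and zero at the larger point `2 - q⁻¹`, which lies in
  -- `[0.9, 1)`.
  · have h1 := hmono (a := 0.496) (b := 2 - q⁻¹) ⟨by norm_num, by norm_num⟩
      ⟨by linarith, by linarith⟩ (by linarith)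
    have h2 := hmid 0.496 ⟨by norm_num, by norm_num⟩
    have h3 := hstrong (2 - q⁻¹) ⟨by linarith, by linarith⟩ le_rfl
    simp only at h1
    linarith
  · have hd' : (2 : ℝ) ≤ d := by exact_mod_cast hd
    have hden : (0 : ℝ) < 1 + q * d := by positivity
    have hlt : 1 / (2 * (1 + q * d)) < 1 / (1 + q * d) :=
      one_div_lt_one_div_of_lt hden (by linarith)
    have hpos : 0 < 1 / (2 * (1 + q * d)) := by positivity
    have hle : 1 / (2 * (1 + q * d)) ≤ 1 / 4 := by
      refine one_div_le_one_div_of_le (by norm_num) ?_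
      nlinarith [hq.1]
    -- Half of the weak-drift threshold is a point of `(0, 1/4]` where the probability is zero, to
    -- the left of `0.496`.
    have h1 := hanti (a := 1 / (2 * (1 + q * d))) (b := 0.496) ⟨hpos, by linarith⟩
      ⟨by norm_num, by norm_num⟩ (by linarith)
    have h2 := hmid 0.496 ⟨by norm_num, by norm_num⟩
    have h3 := hweak _ ⟨hpos.le, by linarith⟩ hlt
    simp only at h1
    linarith
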